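/- Let $k\ge 2$ and $q\ge 2$ be integers and $J>0$. Let $V$ be the vertex set of the Cayley tree of order $k$ (the infinite tree in which every vertex has exactly $k+1$ neighbours), with root $x^0$; let $W_n$ and $V_n$ be the sets of vertices at distance $n$, respectively at most $n$, from $x^0$. For a temperature $T>0$, put $\beta=1/T$. Given boundary fields $\tilde h_x=(\tilde h_{1,x},\dots,\tilde h_{q,x})\in\mathbb R^q$, $x\in V$, consider for $n\ge 0$ the probability distributions on $\{1,\dots,q\}^{V_n}$ $$\mu_n(\sigma_n)=Z_n^{-1}\exp\Big\{\beta J\sum_{\langle x,y\rangle\subset V_n}\delta_{\sigma_n(x)\sigma_n(y)}+\sum_{x\in W_n}\tilde h_{\sigma_n(x),x}\Big\},$$ where the first sum runs over the edges with both endpoints in $V_n$ and $Z_n$ is the normalizing constant. If they are compatible, i.e. $\sum_{\omega\in\{1,\dots,q\}^{W_n}}\mu_n(\sigma_{n-1}\vee\omega)=\mu_{n-1}(\sigma_{n-1})$ for all $n\ge1$ and all $\sigma_{n-1}\in\{1,\dots,q\}^{V_{n-1}}$, the probability measure $\mu$ on $\{1,\dots,q\}^V$ with marginals $\mu_n$ on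 $V_n$ is called a splitting Gibbs measure of the ferromagnetic $q$-state Potts model. It is called translation-invariant (a TISGM) if $\tilde h$ can be chosen so that the vector $h_x=(\tilde h_{i,x}-\tilde h_{q,x})_{i=1}^{q-1}$ is the same for all $x\in V\setminus\{x^0\}$. Put $$T_{cr}=\frac{J}{\ln\left(1+\frac{q}{k-1}\right)}.$$ **Theorem.** There are numbers $t_1,\dots,t_{[q/2]}$, depending only on $k$ and $q$, such that for every $J>0$ the critical temperatures $T_{c,m}=J\,t_m$, $m=1,\dots,[q/2]$, satisfy the following. 1. $T_{c,1}>T_{c,2}>\dots>T_{c,[q/2]}\ge T_{cr}$. 2. If $T>T_{c,1}$, then there is exactly one TISGM. 3. If $T_{c,m+1}<T<T_{c,m}$ for some $m=1,\dots,[q/2]-1$, then there are exactly $1+2\sum_{s=1}^m\binom qs$ TISGMs. 4. If $T<T_{c,[q/2]}$ and $T\ne T_{cr}$, then there are exactly $2^q-1$ TISGMs. 5. If $T=T_{cr}$, then the number of TISGMs is exactly $2^{q-1}$ if $q$ is odd, and $2^{q-1}-\binom{q-1}{q/2}$ if $q$ is even. 6. If $T=T_{c,m}$ for some $m\in\{1,\dots,[q/2]\}$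 with $T_{c,m}\ne T_{cr}$, then there are exactly $1+\binom qm+2\sum_{s=1}^{m-1}\binom qs$ TISGMs. -/

import Mathlib

/-- A Cayley tree of order `k` on the vertex set `V`: a connected graph without cycles in which
every vertex has exactly `k + 1` neighbours, together with a fixed root. -/
structure CayleyTree (k : ℕ) (V : Type*) where
  graph : SimpleGraph V
  isTree : graph.IsTree
  ncard_neighborSet : ∀ x, (graph.neighborSet x).ncard = k + 1
  root : V

namespace CayleyTree

variable {k : ℕ} {V : Type*}

/-- `W_n`, the set of vertices at distance `n` from the root. -/
def sphere (Γ : CayleyTree k V) (n : ℕ) : Set V := {x | Γ.graph.dist Γ.root x = n}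

/-- `V_n`, the set of vertices at distance at most `n` from the root. -/
def ball (Γ : CayleyTree k V) (n : ℕ) : Set V := {x | Γ.graph.dist Γ.root x ≤ n}

theorem sphere_subset_ball (Γ : CayleyTree k V) (n : ℕ) : Γ.sphere n ⊆ Γ.ball n :=
  fun _ hx => le_of_eq hx

theorem finite_ball (Γ : CayleyTree k V) (n : ℕ) : (Γ.ball n).Finite := by
  have hconn : Γ.graph.Connected := Γ.isTree.connected
  induction n with
  | zero =>
    refine (Set.finite_singleton Γ.root).subset fun x hx => ?_
    have h0 : Γ.graph.dist Γ.root x = 0 := Nat.le_zero.mp hx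
    exact (hconn.dist_eq_zero_iff.mp h0).symm
  | succ n ih =>
    have hfin : (⋃ x ∈ Γ.ball n, Γ.graph.neighborSet x).Finite :=
      ih.biUnion fun x _ => Set.finite_of_ncard_pos (by rw [Γ.ncard_neighborSet x]; omega)
    refine (ih.union hfin).subset fun x hx => ?_
    by_cases hle : Γ.graph.dist Γ.root x ≤ n
    · exact Or.inl hle
    · have hd : Γ.graph.dist x Γ.root = n + 1 := by
        rw [SimpleGraph.dist_comm]
        exact le_antisymm hx (by omega)
      obtain ⟨p, hp⟩ := hconn.exists_walk_length_eq_dist x Γ.root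
      rw [hd] at hp
      cases p with
      | nil => simp at hp
      | cons hadj p' =>
        right
        simp only [Set.mem_iUnion]
        refine ⟨_, ?_, hadj.symm⟩
        have hlen := SimpleGraph.dist_le p'
        rw [SimpleGraph.Walk.length_cons] at hp
        rw [SimpleGraph.dist_comm] at hlen
        exact hlen.trans (by omega)

noncomputable instance fintypeBall (Γ : CayleyTree k V) (n : ℕ) : Fintype (Γ.ball n) :=
  (Γ.finite_ball n).fintype

noncomputable instance fintypeSphere (Γ : CayleyTree k V) (n : ℕ) : Fintype (Γ.sphere n) :=
  ((Γ.finite_ball n).subset (Γ.sphere_subset_ball n)).fintype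

/-- `σ_n ∨ ω_{n+1}`, the concatenation of a configuration on `V_n` and one on `W_{n+1}`. -/
noncomputable def concat (Γ : CayleyTree k V) {q n : ℕ} (σ : Γ.ball n → Fin q)
    (ω : Γ.sphere (n + 1) → Fin q) : Γ.ball (n + 1) → Fin q := fun x =>
  if h : Γ.graph.dist Γ.root x.1 ≤ n then σ ⟨x.1, h⟩
  else ω ⟨x.1, le_antisymm x.2 (Nat.lt_of_not_le h)⟩

end CayleyTree

namespace Potts

open scoped Classical

variable {k : ℕ} {V : Type*}

/-- The Potts Hamiltonian in the volume `V_n`: `-J` times the number of edges inside `V_n` whose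
endpoints carry the same spin. The set of spin values is `Fin q`. -/
noncomputable def hamiltonian (Γ : CayleyTree k V) {q : ℕ} (J : ℝ) (n : ℕ)
    (σ : Γ.ball n → Fin q) : ℝ :=
  -J * ∑ e ∈ (Γ.graph.induce (Γ.ball n)).edgeFinset, if (e.map σ).IsDiag then 1 else 0

/-- The unnormalized weight `exp(-β H_n(σ_n) + ∑_{x ∈ W_n} h_{σ(x),x})`, where `β = 1 / T` and
`h x i` is the boundary field at the vertex `x` and the spin value `i`. -/
noncomputable def weight (Γ : CayleyTree k V) {q : ℕ} (J T : ℝ) (h : V → Fin q → ℝ) (n : ℕ)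
    (σ : Γ.ball n → Fin q) : ℝ :=
  Real.exp (-(1 / T) * hamiltonian Γ J n σ +
    ∑ x : Γ.ball n with x.1 ∈ Γ.sphere n, h x.1 (σ x))

/-- The finite-dimensional distribution `μ_n` on the configurations on `V_n`. -/
noncomputable def finiteDist (Γ : CayleyTree k V) {q : ℕ} (J T : ℝ) (h : V → Fin q → ℝ) (n : ℕ)
    (σ : Γ.ball n → Fin q) : ℝ :=
  weight Γ J T h n σ / ∑ τ : Γ.ball n → Fin q, weight Γ J T h n τ

/-- Compatibility of the distributions `μ_n`, `n ≥ 0`. -/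
def Compatible (Γ : CayleyTree k V) {q : ℕ} (J T : ℝ) (h : V → Fin q → ℝ) : Prop :=
  ∀ (n : ℕ) (σ : Γ.ball n → Fin q),
    ∑ ω : Γ.sphere (n + 1) → Fin q, finiteDist Γ J T h (n + 1) (Γ.concat σ ω) =
      finiteDist Γ J T h n σ

/-- `μ` is the splitting Gibbs measure given by the boundary field `h`: the distributions `μ_n`
are compatible and are the marginals of the probability measure `μ` on the volumes `V_n`. -/
def IsSplittingGibbs (Γ : CayleyTree k V) {q : ℕ} (J T : ℝ) (h : V → Fin q → ℝ)
    (μ : MeasureTheory.Measure (V → Fin q)) : Prop :=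
  MeasureTheory.IsProbabilityMeasure μ ∧ Compatible Γ J T h ∧
    ∀ (n : ℕ) (σ : Γ.ball n → Fin q),
      μ.real {ω | ∀ x : Γ.ball n, ω x.1 = σ x} = finiteDist Γ J T h n σ

/-- The boundary field is translation invariant: modulo an additive constant at each vertex, to
which the distributions `μ_n` are insensitive, it is one and the same vector at all vertices other
than the root. (The root has `k + 1` direct successors instead of `k`; the field there enters only
`μ_0`, and the compatibility of `μ_1` with `μ_0` determines it modulo a constant.) -/
def IsTranslationInvariantField (Γ : CayleyTree k V) {q : ℕ} (h : V → Fin q → ℝ) : Prop :=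
  ∃ h₀ : Fin q → ℝ, ∀ x, x ≠ Γ.root → ∀ i j, h x i - h x j = h₀ i - h₀ j

/-- The set of translation-invariant splitting Gibbs measures of the `q`-state Potts model with
coupling constant `J` at the temperature `T`. -/
def TISGM (Γ : CayleyTree k V) (q : ℕ) (J T : ℝ) : Set (MeasureTheory.Measure (V → Fin q)) :=
  {μ | ∃ h : V → Fin q → ℝ, IsTranslationInvariantField Γ h ∧ IsSplittingGibbs Γ J T h μ}

/-- The temperature `T_cr = J / ln(1 + q / (k - 1))`. -/
noncomputable def Tcr (k q : ℕ) (J : ℝ) : ℝ := J / Real.log (1 + (q : ℝ) / ((k : ℝ) - 1))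

end Potts

/-!
Write `c = exp (J / T) - 1`. A translation-invariant field `h₀`, modulo constants, is compatible if
and only if `exp (h₀ i)` is proportional to `(c * exp (h₀ i) + ∑ j, exp (h₀ j)) ^ k`. With
`exp (h₀ i)` proportional to `y i ^ k` and `min y = 1` this becomes the equation
`c * y i ^ k + S = (c + S) * y i`, where `S = ∑ j, y j ^ k` (`fixedPoints`).

*Measures and boundary laws* (`encard_TISGM`). The map from TISGMs to solutions is read off at
constant configurations: compatibility of `μ_2` with `μ_1` gives the equation, and `μ_1` determines
the solution. Conversely a solution gives the transition matrix of a Markov chain on the tree. It is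
realized on a product space in which each vertex carries, for every possible spin of its parent, an
independent random spin; its cylinder probabilities are proportional to the weights, which makes the
distributions `μ_n` compatible without a further computation (`isSplittingGibbs_of_proportional`).
Finally the fields with the same solution have the same `μ_n` for `n ≥ 1`, and these determine the
measure.

*Counting boundary laws* (`encard_fixedPoints`). By strict convexity of `x ^ k` a solution takes at
most two values, `1` and `r > 1`. If `r` is taken on `m` spins, the equation is `ηₘ r = c` with
`ηₘ x = (m * x ^ k + (q - m)) / (x + ⋯ + x ^ (k - 1))` (`ratioCurve`). Hence there is one constant
solution and `∑ m, q.choose m * #{r > 1 | ηₘ r = c}` others.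

*The curves* (`exists_criticalValues`). The derivative of `ηₘ` has the sign of the increasing
function `∑ j, (k - j) * (m * x ^ j - (q - m) * x ^ (-j))`, so that `ηₘ` is unimodal on `[1, ∞)`.
Its minimum `κ m` is attained beyond `1` exactly if `m < q / 2`, and increases with `m` up to
`ηₘ 1 = q / (k - 1)`, which is the value of `c` at `T_cr`. The critical temperatures are those at
which `c = κ m`, that is `J / log (1 + κ m)`.
-/

/-! ### The curves whose level sets are the ratios -/

namespace Potts

/-- The function `η` on the positive half-line whose level sets are the ratios of the two values
taken by a non-constant fixed point: a fixed point with the larger value on `m` of the `q` spins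
has ratio `r > 1` with `η r = exp (J / T) - 1`. The parameters `q` and `m` are real. -/
noncomputable def ratioCurve (k : ℕ) (q m x : ℝ) : ℝ :=
  (m * x ^ k + (q - m)) / ∑ j ∈ Finset.Ico 1 k, x ^ j

/-- The derivative of `ratioCurve` up to a positive factor. -/
noncomputable def ratioSlope (k : ℕ) (q m x : ℝ) : ℝ :=
  ∑ j ∈ Finset.Ico 1 k, ((k : ℝ) - j) * (m * x ^ j - (q - m) * (x ^ j)⁻¹)

variable {k : ℕ} {q m : ℝ}

theorem geom_denom_pos (hk : 2 ≤ k) {x : ℝ} (hx : 0 < x) : 0 < ∑ j ∈ Finset.Ico 1 k, x ^ j :=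
  Finset.sum_pos (fun _ _ => pow_pos hx _) ⟨1, by simp; omega⟩

theorem hasDerivAt_ratioCurve (hk : 2 ≤ k) {x : ℝ} (hx : 0 < x) :
    HasDerivAt (ratioCurve k q m)
      (x ^ (k - 1) * ratioSlope k q m x / (∑ j ∈ Finset.Ico 1 k, x ^ j) ^ 2) x := by
  have hN : HasDerivAt (fun x : ℝ => m * x ^ k + (q - m)) (m * (k * x ^ (k - 1))) x :=
    ((hasDerivAt_pow k x).const_mul m).add_const _
  have hD : HasDerivAt (fun x : ℝ => ∑ j ∈ Finset.Ico 1 k, x ^ j)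
      (∑ j ∈ Finset.Ico 1 k, (j : ℝ) * x ^ (j - 1)) x :=
    HasDerivAt.fun_sum fun j _ => hasDerivAt_pow j x
  refine HasDerivAt.congr_deriv (f := ratioCurve k q m) (hN.div hD (geom_denom_pos hk hx).ne') ?_
  congr 1
  -- reflecting `j ↦ k - j` in the sum for the derivative of the denominator
  have hrefl : ∑ j ∈ Finset.Ico 1 k, (j : ℝ) * x ^ (j - 1) =
      ∑ j ∈ Finset.Ico 1 k, ((k : ℝ) - j) * x ^ (k - j - 1) := by
    refine Finset.sum_nbij' (fun j => k - j) (fun j => k - j) ?_ ?_ ?_ ?_ ?_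
    · intro j hj; simp only [Finset.mem_Ico] at hj ⊢; omega
    · intro j hj; simp only [Finset.mem_Ico] at hj ⊢; omega
    · intro j hj; simp only [Finset.mem_Ico] at hj; omega
    · intro j hj; simp only [Finset.mem_Ico] at hj; omega
    · intro j hj
      simp only [Finset.mem_Ico] at hj
      rw [Nat.cast_sub hj.2.le, Nat.sub_sub_self hj.2.le]; ring
  have hpos : ∀ j ∈ Finset.Ico 1 k, x ^ k * x ^ (j - 1) = x ^ (k - 1) * x ^ j := by
    intro j hj
    simp only [Finset.mem_Ico] at hj
    rw [← pow_add, ← pow_add]; congr 1; omega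
  have hneg : ∀ j ∈ Finset.Ico 1 k, x ^ (k - 1) * (x ^ j)⁻¹ = x ^ (k - j - 1) := by
    intro j hj
    simp only [Finset.mem_Ico] at hj
    rw [← div_eq_mul_inv, div_eq_iff (pow_pos hx _).ne', ← pow_add]; congr 1; omega
  have e1 : x ^ k * ∑ j ∈ Finset.Ico 1 k, (j : ℝ) * x ^ (j - 1) =
      ∑ j ∈ Finset.Ico 1 k, (j : ℝ) * (x ^ (k - 1) * x ^ j) := by
    rw [Finset.mul_sum]
    exact Finset.sum_congr rfl fun j hj => by rw [← hpos j hj]; ring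
  have e2 : ∑ j ∈ Finset.Ico 1 k, (j : ℝ) * x ^ (j - 1) =
      ∑ j ∈ Finset.Ico 1 k, ((k : ℝ) - j) * (x ^ (k - 1) * (x ^ j)⁻¹) :=
    hrefl.trans (Finset.sum_congr rfl fun j hj => by rw [hneg j hj])
  have e3 : x ^ (k - 1) * ratioSlope k q m x =
      m * (k * x ^ (k - 1)) * ∑ j ∈ Finset.Ico 1 k, x ^ j -
        m * ∑ j ∈ Finset.Ico 1 k, (j : ℝ) * (x ^ (k - 1) * x ^ j) -
        (q - m) * ∑ j ∈ Finset.Ico 1 k, ((k : ℝ) - j) * (x ^ (k - 1) * (x ^ j)⁻¹) := by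
    simp only [ratioSlope, Finset.mul_sum, ← Finset.sum_sub_distrib]
    exact Finset.sum_congr rfl fun j _ => by ring
  rw [e3, ← e1, ← e2]
  ring

theorem ratioSlope_strictMonoOn (hk : 2 ≤ k) (hm : 0 < m) (hmq : m ≤ q) :
    StrictMonoOn (ratioSlope k q m) (Set.Ioi 0) := by
  intro x hx y hy hxy
  have hx : 0 < x := hx
  refine Finset.sum_lt_sum_of_nonempty ⟨1, by simp; omega⟩ fun j hj => ?_
  simp only [Finset.mem_Ico] at hj
  have hkj : (0 : ℝ) < (k : ℝ) - j := sub_pos.2 (by exact_mod_cast hj.2)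
  have hpow : x ^ j < y ^ j := pow_lt_pow_left₀ hxy hx.le (by omega)
  have hinv : (y ^ j)⁻¹ ≤ (x ^ j)⁻¹ := inv_anti₀ (pow_pos hx _) hpow.le
  have h1 := mul_lt_mul_of_pos_left hpow hm
  have h2 := mul_le_mul_of_nonneg_left hinv (sub_nonneg.2 hmq)
  exact mul_lt_mul_of_pos_left (by linarith) hkj

theorem continuousOn_ratioSlope : ContinuousOn (ratioSlope k q m) (Set.Ioi 0) := by
  unfold ratioSlope
  refine continuousOn_finsetSum _ fun j _ => ?_
  refine continuousOn_const.mul ((continuousOn_const.mul (continuousOn_pow j)).sub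
    (continuousOn_const.mul ((continuousOn_pow j).inv₀ fun x hx => (pow_pos hx j).ne')))

theorem ratioCurve_one (hk : 2 ≤ k) : ratioCurve k q m 1 = q / ((k : ℝ) - 1) := by
  simp [ratioCurve, Nat.cast_sub (show 1 ≤ k by omega)]

theorem continuousOn_ratioCurve (hk : 2 ≤ k) :
    ContinuousOn (ratioCurve k q m) (Set.Ici 1) := fun _ hx =>
  (hasDerivAt_ratioCurve hk (one_pos.trans_le hx)).continuousAt.continuousWithinAt

/-- `ratioCurve` is unimodal on `[1, ∞)`; its minimum is attained in the interior exactly if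
`m < q / 2`. -/
theorem exists_ratioCurve_unimodal (hk : 2 ≤ k) (hm : 1 ≤ m) (hmq : m < q) :
    ∃ a : ℝ, 1 ≤ a ∧ (2 * m < q → 1 < a) ∧ (q ≤ 2 * m → a = 1) ∧
      StrictAntiOn (ratioCurve k q m) (Set.Icc 1 a) ∧
      StrictMonoOn (ratioCurve k q m) (Set.Ici a) := by
  have hmono := ratioSlope_strictMonoOn hk (one_pos.trans_le hm) hmq.le
  have hderiv : ∀ x, 0 < x → deriv (ratioCurve k q m) x =
      x ^ (k - 1) * ratioSlope k q m x / (∑ j ∈ Finset.Ico 1 k, x ^ j) ^ 2 :=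
    fun x hx => (hasDerivAt_ratioCurve hk hx).deriv
  have hup : ∀ a, 1 ≤ a → 0 ≤ ratioSlope k q m a →
      StrictMonoOn (ratioCurve k q m) (Set.Ici a) := by
    intro a ha h0
    refine strictMonoOn_of_deriv_pos (convex_Ici a)
      ((continuousOn_ratioCurve hk).mono (Set.Ici_subset_Ici.2 ha)) fun x hx => ?_
    rw [interior_Ici] at hx
    have hx0 : 0 < x := by linarith [Set.mem_Ioi.1 hx]
    rw [hderiv x hx0]
    have := hmono (show (0 : ℝ) < a by linarith) hx0 hx
    have := geom_denom_pos hk hx0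
    have : 0 < ratioSlope k q m x := by linarith
    positivity
  rcases le_or_gt q (2 * m) with h | h
  · refine ⟨1, le_rfl, fun h' => absurd h' (not_lt.2 h), fun _ => rfl, by simp, ?_⟩
    refine hup 1 le_rfl (Finset.sum_nonneg fun j hj => ?_)
    simp only [Finset.mem_Ico] at hj
    have hkj : (0 : ℝ) < (k : ℝ) - j := sub_pos.2 (by exact_mod_cast hj.2)
    simp only [one_pow, inv_one, mul_one]
    exact mul_nonneg hkj.le (by linarith)
  · have h1 : ratioSlope k q m 1 < 0 := by
      refine Finset.sum_neg (fun j hj => ?_) ⟨1, by simp; omega⟩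
      simp only [Finset.mem_Ico] at hj
      have hkj : (0 : ℝ) < (k : ℝ) - j := sub_pos.2 (by exact_mod_cast hj.2)
      simp only [one_pow, inv_one, mul_one]
      exact mul_neg_of_pos_of_neg hkj (by linarith)
    have h2 : 0 < ratioSlope k q m q := by
      refine Finset.sum_pos (fun j hj => ?_) ⟨1, by simp; omega⟩
      simp only [Finset.mem_Ico] at hj
      have hkj : (0 : ℝ) < (k : ℝ) - j := sub_pos.2 (by exact_mod_cast hj.2)
      have hqj : q ≤ q ^ j := le_self_pow₀ (by linarith) (by omega)
      have hinv : (q ^ j)⁻¹ ≤ 1 := inv_le_one_of_one_le₀ (by linarith)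
      have := mul_le_mul_of_nonneg_left hinv (sub_nonneg.2 hmq.le)
      have : q ≤ m * q ^ j := hqj.trans (le_mul_of_one_le_left (by linarith) hm)
      exact mul_pos hkj (by linarith)
    obtain ⟨a, ha, ha0⟩ := intermediate_value_Icc (show (1 : ℝ) ≤ q by linarith)
      (continuousOn_ratioSlope.mono fun x hx => one_pos.trans_le hx.1) ⟨h1.le, h2.le⟩
    have ha1 : 1 < a := lt_of_le_of_ne ha.1 (by rintro rfl; linarith)
    refine ⟨a, ha1.le, fun _ => ha1, fun h' => absurd h (not_lt.2 h'), ?_, hup a ha1.le ha0.ge⟩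
    refine strictAntiOn_of_deriv_neg (convex_Icc 1 a)
      ((continuousOn_ratioCurve hk).mono Set.Icc_subset_Ici_self) fun x hx => ?_
    rw [interior_Icc] at hx
    have hx0 : 0 < x := by linarith [hx.1]
    rw [hderiv x hx0]
    have := hmono hx0 (show (0 : ℝ) < a by linarith) hx.2
    have hD := geom_denom_pos hk hx0
    have : ratioSlope k q m x < 0 := by linarith
    exact div_neg_of_neg_of_pos (mul_neg_of_pos_of_neg (pow_pos hx0 _) this) (by positivity)

theorem ratioCurve_unbounded (hk : 2 ≤ k) (hm : 1 ≤ m) (hmq : m < q) (b c : ℝ) :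
    ∃ x, b < x ∧ c < ratioCurve k q m x := by
  have hk0 : (0 : ℝ) < k := by exact_mod_cast (show 0 < k by omega)
  obtain ⟨x, hx⟩ : ∃ x, max (max b 1) (c * k) < x := exists_gt _
  have hb : b < x := lt_of_le_of_lt ((le_max_left _ _).trans (le_max_left _ _)) hx
  have h1 : 1 < x := lt_of_le_of_lt ((le_max_right _ _).trans (le_max_left _ _)) hx
  have hc : c * k < x := lt_of_le_of_lt (le_max_right _ _) hx
  refine ⟨x, hb, ?_⟩
  have hx0 : 0 < x := by linarith
  have hD := geom_denom_pos hk hx0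
  rw [ratioCurve, lt_div_iff₀ hD]
  rcases le_or_gt c 0 with hc0 | hc0
  · have : 0 < x ^ k := by positivity
    nlinarith
  have hDle : ∑ j ∈ Finset.Ico 1 k, x ^ j ≤ k * x ^ (k - 1) := by
    calc ∑ j ∈ Finset.Ico 1 k, x ^ j ≤ ∑ j ∈ Finset.Ico 1 k, x ^ (k - 1) :=
          Finset.sum_le_sum fun j hj => pow_le_pow_right₀ h1.le (by
            simp only [Finset.mem_Ico] at hj; omega)
      _ = ((k - 1 : ℕ) : ℝ) * x ^ (k - 1) := by simp
      _ ≤ k * x ^ (k - 1) := by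
          gcongr; omega
  have hxk : x ^ k = x * x ^ (k - 1) := by rw [← pow_succ']; congr 1; omega
  have hp : 0 < x ^ (k - 1) := by positivity
  calc c * ∑ j ∈ Finset.Ico 1 k, x ^ j ≤ c * (k * x ^ (k - 1)) := by gcongr
    _ = c * k * x ^ (k - 1) := by ring
    _ < x * x ^ (k - 1) := by gcongr
    _ = x ^ k := hxk.symm
    _ ≤ m * x ^ k := le_mul_of_one_le_left (by positivity) hm
    _ ≤ m * x ^ k + (q - m) := by linarith

end Potts

/-- The number of solutions of `f r = c` on `(1, ∞)` for a function `f` that decreases strictly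
from `f 1` to its minimum at `a ≥ 1` and then increases strictly to infinity. -/
theorem encard_level_of_unimodal {f : ℝ → ℝ} {a c : ℝ} (ha : 1 ≤ a)
    (hf : ContinuousOn f (Set.Ici 1)) (hanti : StrictAntiOn f (Set.Icc 1 a))
    (hmono : StrictMonoOn f (Set.Ici a)) (hunb : ∀ b c, ∃ x, b < x ∧ c < f x) :
    {r | 1 < r ∧ f r = c}.encard =
      ((if 1 < a ∧ f a < c ∧ c < f 1 then 1 else 0) + (if f a < c then 1 else 0) +
        (if 1 < a ∧ f a = c then 1 else 0) : ℕ) := by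
  have hle : ∀ x, 1 ≤ x → f a ≤ f x := by
    intro x hx
    rcases le_total x a with h | h
    · exact hanti.antitoneOn ⟨hx, h⟩ ⟨ha, le_rfl⟩ h
    · exact hmono.monotoneOn Set.self_mem_Ici h h
  have hright : f a < c → ∃ y, a < y ∧ f y = c := by
    intro h
    obtain ⟨x, hax, hx⟩ := hunb a c
    obtain ⟨y, hy, hyc⟩ := intermediate_value_Icc hax.le
      (hf.mono fun z hz => ha.trans hz.1) ⟨h.le, hx.le⟩
    exact ⟨y, lt_of_le_of_ne hy.1 (by rintro rfl; linarith), hyc⟩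
  rcases lt_trichotomy c (f a) with h | h | h
  · have : {r | 1 < r ∧ f r = c} = ∅ := by
      ext r
      simp only [Set.mem_ofPred_eq, Set.mem_empty_iff_false, iff_false, not_and]
      intro hr hrc
      linarith [hle r hr.le]
    rw [this]
    simp [h.not_gt, h.ne']
  · have hset : {r | 1 < r ∧ f r = c} = {r | 1 < r ∧ r = a} := by
      ext r
      simp only [Set.mem_ofPred_eq, and_congr_right_iff]
      intro hr
      refine ⟨fun hrc => ?_, fun hra => by rw [hra, h]⟩
      rcases le_total r a with h' | h'
      · exact hanti.injOn ⟨hr.le, h'⟩ ⟨ha, le_rfl⟩ (hrc.trans h)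
      · exact hmono.injOn h' Set.self_mem_Ici (hrc.trans h)
    rw [hset]
    by_cases h1 : 1 < a
    · have : {r : ℝ | 1 < r ∧ r = a} = {a} := by
        ext r; simp only [Set.mem_ofPred_eq, Set.mem_singleton_iff]
        exact ⟨fun h => h.2, fun h => ⟨h ▸ h1, h⟩⟩
      rw [this]; simp [h, h1]
    · have : {r : ℝ | 1 < r ∧ r = a} = ∅ := by
        ext r; simp only [Set.mem_ofPred_eq, Set.mem_empty_iff_false, iff_false]
        exact fun h => h1 (h.2 ▸ h.1)
      rw [this]; simp [h, h1]
  · obtain ⟨y, hay, hy⟩ := hright h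
    have hyuniq : ∀ r, a ≤ r → f r = c → r = y := fun r hr hrc =>
      hmono.injOn hr hay.le (hrc.trans hy.symm)
    by_cases h1 : 1 < a ∧ c < f 1
    · obtain ⟨x, hx, hxc⟩ := intermediate_value_Icc' h1.1.le
        (hf.mono Set.Icc_subset_Ici_self) ⟨h.le, h1.2.le⟩
      have hx1 : 1 < x := lt_of_le_of_ne hx.1 (by rintro rfl; linarith)
      have hxa : x < a := lt_of_le_of_ne hx.2 (by rintro rfl; linarith)
      have : {r | 1 < r ∧ f r = c} = {x, y} := by
        ext r
        simp only [Set.mem_ofPred_eq, Set.mem_insert_iff, Set.mem_singleton_iff]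
        constructor
        · rintro ⟨hr, hrc⟩
          rcases le_total r a with h' | h'
          · exact Or.inl (hanti.injOn ⟨hr.le, h'⟩ hx (hrc.trans hxc.symm))
          · exact Or.inr (hyuniq r h' hrc)
        · rintro (rfl | rfl)
          exacts [⟨hx1, hxc⟩, ⟨h1.1.trans hay, hy⟩]
      rw [this, Set.encard_pair (by linarith)]
      simp [h, h1, h.ne]
    · have : {r | 1 < r ∧ f r = c} = {y} := by
        ext r
        simp only [Set.mem_ofPred_eq, Set.mem_singleton_iff]
        constructor
        · rintro ⟨hr, hrc⟩
          rcases le_total r a with h' | h'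
          · exfalso
            refine h1 ⟨hr.trans_le h', ?_⟩
            rw [← hrc]
            exact hanti ⟨le_rfl, ha⟩ ⟨hr.le, h'⟩ hr
          · exact hyuniq r h' hrc
        · rintro rfl
          exact ⟨ha.trans_lt hay, hy⟩
      rw [this, Set.encard_singleton]
      have h1' : ¬ (1 < a ∧ f a < c ∧ c < f 1) := fun h' => h1 ⟨h'.1, h'.2.2⟩
      rw [if_neg h1', if_pos h, if_neg fun h' => h.ne h'.2]
      rfl

/-! ### Counting the normalized boundary laws -/

namespace Potts

/-- The translation-invariant boundary laws, normalized: the law `h₀` is written as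
`exp (h₀ i) = λ * y i ^ k` with `min y = 1`, and `c = exp (J / T) - 1`. -/
def fixedPoints (k q : ℕ) (c : ℝ) : Set (Fin q → ℝ) :=
  {y | (∀ i, 1 ≤ y i) ∧ (∃ i, y i = 1) ∧
    ∀ i, c * y i ^ k + ∑ j, y j ^ k = (c + ∑ j, y j ^ k) * y i}

/-- The vector with the entry `r` at the spins in `M` and `1` elsewhere. -/
def twoValued {q : ℕ} (M : Finset (Fin q)) (r : ℝ) : Fin q → ℝ := fun i => if i ∈ M then r else 1

variable {k q : ℕ} {c r : ℝ}

theorem sum_twoValued_pow (M : Finset (Fin q)) :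
    ∑ j, twoValued M r j ^ k = (M.card : ℝ) * r ^ k + ((q : ℝ) - M.card) := by
  have h : ∀ j, twoValued M r j ^ k = (if j ∈ M then r ^ k - 1 else 0) + 1 := by
    intro j; unfold twoValued; split_ifs <;> simp
  simp only [h, Finset.sum_add_distrib, Finset.sum_ite_mem, Finset.univ_inter, Finset.sum_const,
    Finset.card_univ, Fintype.card_fin, nsmul_eq_mul]
  ring

theorem twoValued_mem_fixedPoints_iff (hk : 2 ≤ k) (hr : 1 < r) {M : Finset (Fin q)}
    (hM : M.Nonempty) (hM' : M ≠ Finset.univ) :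
    twoValued M r ∈ fixedPoints k q c ↔ ratioCurve k q M.card r = c := by
  obtain ⟨a, ha⟩ := hM
  obtain ⟨b, hb⟩ : ∃ b, b ∉ M := by
    by_contra! h; exact hM' (Finset.eq_univ_iff_forall.2 h)
  have hD := geom_denom_pos hk (one_pos.trans hr)
  have hgeom : (∑ j ∈ Finset.Ico 1 k, r ^ j) * (r - 1) = r ^ k - r := by
    simpa using geom_sum_Ico_mul r (show 1 ≤ k by omega)
  have hkey : c * r ^ k + ((M.card : ℝ) * r ^ k + ((q : ℝ) - M.card)) =
      (c + ((M.card : ℝ) * r ^ k + ((q : ℝ) - M.card))) * r ↔ ratioCurve k q M.card r = c := by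
    rw [ratioCurve, div_eq_iff hD.ne', ← mul_left_inj' (sub_pos.2 hr).ne' (a := _ + _)
      (b := c * _), mul_assoc, hgeom]
    constructor <;> intro h <;> linear_combination -h
  rw [← hkey]
  constructor
  · rintro ⟨-, -, h⟩
    have := h a
    rw [sum_twoValued_pow] at this
    simpa [twoValued, ha] using this
  · intro h
    refine ⟨fun i => ?_, ⟨b, by simp [twoValued, hb]⟩, fun i => ?_⟩
    · unfold twoValued; split_ifs
      exacts [hr.le, le_rfl]
    · rw [sum_twoValued_pow]
      by_cases hi : i ∈ M
      · simpa [twoValued, hi] using h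
      · simp [twoValued, hi]

/-- By strict convexity of `x ^ k`, an equation `c * x ^ k + S = A * x` has at most one solution
above the solution `x = 1`. -/
theorem eq_of_pow_affine (hk : 2 ≤ k) (hc : 0 < c) {S A x y : ℝ} (h1 : c + S = A) (hx : 1 < x)
    (hy : 1 < y) (hxS : c * x ^ k + S = A * x) (hyS : c * y ^ k + S = A * y) : x = y := by
  have key : ∀ {x y : ℝ}, 1 < x → c * x ^ k + S = A * x → c * y ^ k + S = A * y → ¬ x < y := by
    intro x y hx hxS hyS hxy
    have := (strictConvexOn_pow hk).slope_strict_mono_adjacent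
      (show (1 : ℝ) ∈ Set.Ici 0 by simp) (show y ∈ Set.Ici 0 by simp; linarith) hx hxy
    rw [div_lt_div_iff₀ (by linarith) (by linarith), one_pow] at this
    have := mul_lt_mul_of_pos_left this hc
    have e1 : c * (x ^ k - 1) = A * (x - 1) := by linarith
    have e2 : c * (y ^ k - x ^ k) = A * (y - x) := by linarith
    rw [← mul_assoc, ← mul_assoc, e1, e2] at this
    linarith [mul_right_comm A (x - 1) (y - x)]
  rcases lt_trichotomy x y with h | h | h
  exacts [absurd h (key hx hxS hyS), h, absurd h (key hy hyS hxS)]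

/-- The pairs of a proper nonempty set `M` of spins and a ratio `r > 1` that solves the equation
for `M`. -/
def ratioPairs (k q : ℕ) (c : ℝ) : Set ((_ : Finset (Fin q)) × ℝ) :=
  {p | (p.1.Nonempty ∧ p.1 ≠ Finset.univ) ∧ 1 < p.2 ∧ ratioCurve k q p.1.card p.2 = c}

theorem fixedPoints_eq (hk : 2 ≤ k) (hq : 1 ≤ q) (hc : 0 < c) :
    fixedPoints k q c =
      insert (fun _ => 1) ((fun p => twoValued p.1 p.2) '' ratioPairs k q c) := by
  ext y
  constructor
  · rintro ⟨hle, ⟨b, hb⟩, hfix⟩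
    by_cases hM : ∃ a, 1 < y a
    · obtain ⟨a, ha⟩ := hM
      right
      have hy : twoValued (Finset.univ.filter fun i => 1 < y i) (y a) = y := by
        funext i
        by_cases hi : 1 < y i
        · simp only [twoValued, Finset.mem_filter, Finset.mem_univ, hi, true_and, if_true]
          exact eq_of_pow_affine hk hc rfl ha hi (hfix a) (hfix i)
        · simp only [twoValued, Finset.mem_filter, Finset.mem_univ, hi, true_and, if_false]
          exact le_antisymm (hle i) (not_lt.1 hi)
      have hne : (Finset.univ.filter fun i => 1 < y i).Nonempty := ⟨a, by simp [ha]⟩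
      have hne' : (Finset.univ.filter fun i => 1 < y i) ≠ Finset.univ := by
        intro h
        have := Finset.mem_univ b
        rw [← h] at this
        simp [hb] at this
      refine ⟨⟨_, y a⟩, ⟨⟨hne, hne'⟩, ha, ?_⟩, hy⟩
      refine (twoValued_mem_fixedPoints_iff hk ha hne hne').1 ?_
      rw [hy]
      exact ⟨hle, ⟨b, hb⟩, hfix⟩
    · left
      push Not at hM
      funext i
      exact le_antisymm (hM i) (hle i)
  · rintro (rfl | ⟨p, ⟨⟨h1, h2⟩, h3, h4⟩, rfl⟩)
    · exact ⟨fun _ => le_rfl, ⟨⟨0, hq⟩, rfl⟩, fun _ => by simp⟩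
    · exact (twoValued_mem_fixedPoints_iff hk h3 h1 h2).2 h4

theorem injOn_twoValued :
    Set.InjOn (fun p : (_ : Finset (Fin q)) × ℝ => twoValued p.1 p.2) (ratioPairs k q c) := by
  rintro ⟨M, r⟩ ⟨⟨⟨a, ha⟩, -⟩, hr, -⟩ ⟨M', r'⟩ ⟨-, hr', -⟩ h
  simp only at h hr hr' ha
  have hM : M = M' := by
    ext i
    have := congrFun h i
    unfold twoValued at this
    split_ifs at this with h1 h2 h2
    · simp [h1, h2]
    · linarith
    · linarith
    · simp [h1, h2]
  subst hM
  have := congrFun h a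
  simp only [twoValued, ha, if_true] at this
  rw [this]

theorem encard_fixedPoints (hk : 2 ≤ k) (hq : 1 ≤ q) (hc : 0 < c) (N : ℕ → ℕ)
    (hN : ∀ m : ℕ, 1 ≤ m → m < q → {r | 1 < r ∧ ratioCurve k q m r = c}.encard = N m) :
    (fixedPoints k q c).encard = (1 + ∑ m ∈ Finset.Ico 1 q, q.choose m * N m : ℕ) := by
  have hfin : ∀ m : ℕ, ∃ R : Finset ℝ, 1 ≤ m → m < q →
      (R : Set ℝ) = {r | 1 < r ∧ ratioCurve k q m r = c} ∧ R.card = N m := by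
    intro m
    by_cases hm : 1 ≤ m ∧ m < q
    · have h := hN m hm.1 hm.2
      have hf : {r | 1 < r ∧ ratioCurve k q m r = c}.Finite :=
        Set.finite_of_encard_eq_coe h
      refine ⟨hf.toFinset, fun _ _ => ⟨hf.coe_toFinset, ?_⟩⟩
      rw [hf.encard_eq_coe_toFinset_card] at h
      exact_mod_cast h
    · exact ⟨∅, fun h1 h2 => absurd ⟨h1, h2⟩ hm⟩
  choose R hR using hfin
  have hcard : ∀ M : Finset (Fin q), M.Nonempty ∧ M ≠ Finset.univ ↔ 1 ≤ M.card ∧ M.card < q := by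
    intro M
    rw [Nat.succ_le_iff, Finset.card_pos]
    refine and_congr_right fun _ => ?_
    rw [← Finset.card_lt_iff_ne_univ, Fintype.card_fin]
  have hpairs : ratioPairs k q c = ((((Finset.univ : Finset (Fin q)).powerset.filter
      fun M => 1 ≤ M.card ∧ M.card < q).sigma fun M => R M.card :
        Finset ((_ : Finset (Fin q)) × ℝ)) : Set _) := by
    ext p
    simp only [ratioPairs, Set.mem_ofPred_eq, hcard, Finset.mem_coe, Finset.mem_sigma,
      Finset.mem_filter, Finset.mem_powerset, Finset.subset_univ, true_and]
    refine and_congr_right fun h => ?_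
    have := (hR _ h.1 h.2).1
    rw [← Finset.mem_coe, this]
    rfl
  rw [fixedPoints_eq hk hq hc, Set.encard_insert_of_notMem, injOn_twoValued.encard_image, hpairs,
    Set.encard_coe_eq_coe_finsetCard, Finset.card_sigma, add_comm]
  · norm_cast
    congr 1
    have h1 : ∑ M ∈ (Finset.univ : Finset (Fin q)).powerset with 1 ≤ M.card ∧ M.card < q,
        (R M.card).card = ∑ M ∈ (Finset.univ : Finset (Fin q)).powerset,
          (fun m => if 1 ≤ m ∧ m < q then N m else 0) M.card := by
      rw [Finset.sum_filter]
      refine Finset.sum_congr rfl fun M _ => ?_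
      by_cases h : 1 ≤ M.card ∧ M.card < q
      · simp [h, (hR _ h.1 h.2).2]
      · simp only [h, if_false]
    rw [h1, Finset.sum_powerset_apply_card (fun m => if 1 ≤ m ∧ m < q then N m else 0)]
    simp only [Finset.card_univ, Fintype.card_fin, smul_eq_mul, mul_ite, mul_zero]
    rw [← Finset.sum_filter]
    refine Finset.sum_congr ?_ fun _ _ => rfl
    ext m
    simp only [Finset.mem_filter, Finset.mem_range, Finset.mem_Ico]
    omega
  · rintro ⟨p, ⟨⟨⟨a, ha⟩, -⟩, hr, -⟩, h⟩
    have := congrFun h a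
    simp only [twoValued, ha, if_true] at this
    linarith

end Potts

/-! ### The tree seen from the root -/

namespace CayleyTree

variable {k : ℕ} {V : Type*} (Γ : CayleyTree k V)

theorem exists_parent {x : V} (hx : x ≠ Γ.root) :
    ∃ p, Γ.graph.Adj p x ∧ Γ.graph.dist Γ.root p + 1 = Γ.graph.dist Γ.root x := by
  obtain ⟨w, hw⟩ := Γ.isTree.connected.exists_walk_length_eq_dist x Γ.root
  cases w with
  | nil => exact absurd rfl hx
  | @cons _ p _ hadj w' =>
    refine ⟨p, hadj.symm, ?_⟩
    have hlen := SimpleGraph.dist_le w'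
    rw [SimpleGraph.Walk.length_cons, SimpleGraph.dist_comm] at hw
    rw [SimpleGraph.dist_comm] at hlen
    rcases Γ.isTree.dist_eq_dist_add_one_of_adj Γ.root hadj <;> omega

open scoped Classical in
/-- The neighbour of `x` on the way to the root; the root is its own parent. -/
noncomputable def parent (x : V) : V :=
  if hx : x ≠ Γ.root then (Γ.exists_parent hx).choose else Γ.root

variable {Γ}

theorem parent_adj {x : V} (hx : x ≠ Γ.root) : Γ.graph.Adj (Γ.parent x) x := by
  rw [parent, dif_pos hx]; exact (Γ.exists_parent hx).choose_spec.1

theorem dist_parent {x : V} (hx : x ≠ Γ.root) :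
    Γ.graph.dist Γ.root (Γ.parent x) + 1 = Γ.graph.dist Γ.root x := by
  rw [parent, dif_pos hx]; exact (Γ.exists_parent hx).choose_spec.2

/-- Two neighbours of `x` closer to the root would give two paths from `x` to the root. -/
theorem eq_parent {x p : V} (hadj : Γ.graph.Adj p x)
    (hd : Γ.graph.dist Γ.root p + 1 = Γ.graph.dist Γ.root x) : p = Γ.parent x := by
  have hx : x ≠ Γ.root := by
    rintro rfl
    simp at hd
  have key : ∀ p' (_ : Γ.graph.Adj p' x), Γ.graph.dist Γ.root p' + 1 = Γ.graph.dist Γ.root x →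
      ∃ w : Γ.graph.Walk x Γ.root, w.IsPath ∧ w.snd = p' := by
    intro p' hadj' hd'
    obtain ⟨w, hw⟩ := Γ.isTree.connected.exists_walk_length_eq_dist p' Γ.root
    refine ⟨.cons hadj'.symm w, SimpleGraph.Walk.isPath_of_length_eq_dist _ ?_, by simp⟩
    rw [SimpleGraph.Walk.length_cons, hw, SimpleGraph.dist_comm, hd', SimpleGraph.dist_comm]
  obtain ⟨w, hw, rfl⟩ := key p hadj hd
  obtain ⟨w', hw', h'⟩ := key _ (parent_adj hx) (dist_parent hx)
  rw [← h', (Γ.isTree.existsUnique_path x Γ.root).unique hw hw']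

theorem adj_iff {x y : V} : Γ.graph.Adj x y ↔
    (y ≠ Γ.root ∧ Γ.parent y = x) ∨ (x ≠ Γ.root ∧ Γ.parent x = y) := by
  constructor
  · intro h
    rcases Γ.isTree.dist_eq_dist_add_one_of_adj Γ.root h with hd | hd
    · right
      exact ⟨by rintro rfl; simp at hd, (eq_parent h.symm hd.symm).symm⟩
    · left
      exact ⟨by rintro rfl; simp at hd, (eq_parent h hd.symm).symm⟩
  · rintro (⟨h, rfl⟩ | ⟨h, rfl⟩)
    exacts [parent_adj h, (parent_adj h).symm]

variable (Γ)

/-- `V_n` as a `Finset`. -/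
noncomputable def ballFinset (n : ℕ) : Finset V := (Γ.finite_ball n).toFinset

/-- `W_n` as a `Finset`. -/
noncomputable def sphereFinset (n : ℕ) : Finset V :=
  ((Γ.finite_ball n).subset (Γ.sphere_subset_ball n)).toFinset

variable {Γ} {n : ℕ}

@[simp] theorem mem_ballFinset {x : V} : x ∈ Γ.ballFinset n ↔ Γ.graph.dist Γ.root x ≤ n := by
  simp [ballFinset, ball]

@[simp] theorem mem_sphereFinset {x : V} :
    x ∈ Γ.sphereFinset n ↔ Γ.graph.dist Γ.root x = n := by
  simp [sphereFinset, sphere]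

theorem dist_root_eq_zero_iff {x : V} : Γ.graph.dist Γ.root x = 0 ↔ x = Γ.root := by
  rw [Γ.isTree.connected.dist_eq_zero_iff, eq_comm]

theorem ne_root_of_mem_sphereFinset {x : V} (hx : x ∈ Γ.sphereFinset (n + 1)) : x ≠ Γ.root := by
  rintro rfl
  simp at hx

theorem parent_mem_sphereFinset {x : V} (hx : x ∈ Γ.sphereFinset (n + 1)) :
    Γ.parent x ∈ Γ.sphereFinset n := by
  have := dist_parent (ne_root_of_mem_sphereFinset hx)
  simp only [mem_sphereFinset] at hx ⊢
  omega

open scoped Classical in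
theorem card_children {x : V} (hx : x ∈ Γ.sphereFinset n) :
    ((Γ.sphereFinset (n + 1)).filter fun y => Γ.parent y = x).card =
      if n = 0 then k + 1 else k := by
  rw [mem_sphereFinset] at hx
  have hchild : ∀ y, y ∈ (Γ.sphereFinset (n + 1)).filter (fun y => Γ.parent y = x) ↔
      y ≠ Γ.root ∧ Γ.parent y = x := by
    intro y
    rw [Finset.mem_filter]
    refine and_congr_left fun hy => ⟨ne_root_of_mem_sphereFinset, fun h => ?_⟩
    have := dist_parent h
    rw [hy, hx] at this
    rw [mem_sphereFinset, this]
  split_ifs with hn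
  · have hx0 : x = Γ.root := dist_root_eq_zero_iff.1 (hx.trans hn)
    rw [← Γ.ncard_neighborSet x, ← Set.ncard_coe_finset]
    congr 1
    ext y
    rw [Finset.mem_coe, hchild, SimpleGraph.mem_neighborSet, adj_iff]
    simp [hx0]
  · have hx0 : x ≠ Γ.root := fun h => hn (by rw [← hx, h, SimpleGraph.dist_self])
    have hset : Γ.graph.neighborSet x =
        insert (Γ.parent x)
          (((Γ.sphereFinset (n + 1)).filter fun y => Γ.parent y = x : Finset V) : Set V) := by
      ext y
      rw [Set.mem_insert_iff, Finset.mem_coe, hchild, SimpleGraph.mem_neighborSet, adj_iff, or_comm]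
      simp [hx0, eq_comm]
    have hnot : Γ.parent x ∉
        ((Γ.sphereFinset (n + 1)).filter fun y => Γ.parent y = x : Finset V) := by
      intro h
      have h1 := (Finset.mem_filter.1 h).1
      rw [mem_sphereFinset] at h1
      have := dist_parent hx0
      omega
    have := Γ.ncard_neighborSet x
    rw [hset, ← Finset.coe_insert, Set.ncard_coe_finset, Finset.card_insert_of_notMem hnot] at this
    omega

theorem sphereFinset_nonempty (n : ℕ) (hk : 1 ≤ k) : (Γ.sphereFinset n).Nonempty := by
  classical
  induction n with
  | zero => exact ⟨Γ.root, by simp⟩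
  | succ n ih =>
    obtain ⟨x, hx⟩ := ih
    have := card_children hx
    have hpos : 0 < ((Γ.sphereFinset (n + 1)).filter fun y => Γ.parent y = x).card := by
      rw [this]; split_ifs <;> omega
    obtain ⟨y, hy⟩ := Finset.card_pos.1 hpos
    exact ⟨y, (Finset.mem_filter.1 hy).1⟩

/-- Every vertex of `W_n` is the parent of `k` vertices, the root of `k + 1`. -/
theorem prod_parent {M : Type*} [CommMonoid M] (f : V → M) :
    ∏ y ∈ Γ.sphereFinset (n + 1), f (Γ.parent y) =
      ∏ x ∈ Γ.sphereFinset n, f x ^ (if n = 0 then k + 1 else k) := by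
  classical
  rw [← Finset.prod_fiberwise_of_maps_to (fun y hy => parent_mem_sphereFinset hy)]
  refine Finset.prod_congr rfl fun x hx => ?_
  rw [← card_children hx, ← Finset.prod_const]
  exact Finset.prod_congr rfl fun y hy => by rw [(Finset.mem_filter.1 hy).2]

open scoped Classical in
theorem prod_ballFinset_succ {M : Type*} [CommMonoid M] (f : V → M) :
    ∏ y ∈ (Γ.ballFinset (n + 1)).erase Γ.root, f y =
      (∏ y ∈ (Γ.ballFinset n).erase Γ.root, f y) * ∏ y ∈ Γ.sphereFinset (n + 1), f y := by
  rw [← Finset.prod_union]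
  · refine Finset.prod_congr ?_ fun _ _ => rfl
    ext y
    simp only [Finset.mem_erase, Finset.mem_union, mem_ballFinset, mem_sphereFinset]
    constructor
    · rintro ⟨h1, h2⟩
      rcases Nat.lt_or_ge n (Γ.graph.dist Γ.root y) with h | h
      · right; omega
      · exact Or.inl ⟨h1, h⟩
    · rintro (⟨h1, h2⟩ | h)
      · exact ⟨h1, by omega⟩
      · exact ⟨by rintro rfl; simp at h, h.le⟩
  · rw [Finset.disjoint_left]
    intro y hy hy'
    simp only [Finset.mem_erase, mem_ballFinset, mem_sphereFinset] at hy hy'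
    omega

open scoped Classical in
/-- The configuration equal to `ω` on `W_{n+1}` and to `s` elsewhere. -/
noncomputable def glue {q : ℕ} (s : V → Fin q) (ω : Γ.sphere (n + 1) → Fin q) : V → Fin q :=
  fun x => if h : x ∈ Γ.sphere (n + 1) then ω ⟨x, h⟩ else s x

theorem concat_restrict {q : ℕ} (s : V → Fin q) (ω : Γ.sphere (n + 1) → Fin q) :
    Γ.concat (fun x : Γ.ball n => s x.1) ω = fun x => glue s ω x.1 := by
  funext x
  unfold concat glue
  split_ifs with h1 h2 h2
  · exact absurd (show Γ.graph.dist Γ.root x.1 = n + 1 from h2) (by omega)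
  · rfl
  · rfl
  · exact absurd (show Γ.graph.dist Γ.root x.1 = n + 1 from le_antisymm x.2 (by omega)) h2

end CayleyTree

/-! ### The weights in terms of parents -/

namespace Potts

open CayleyTree
open scoped Classical

variable {k q n : ℕ} {V : Type*} {Γ : CayleyTree k V}

/-- The edges of `V_n` are parametrized by their lower endpoints, the vertices of `V_n` other than
the root. -/
theorem hamiltonian_restrict (J : ℝ) (n : ℕ) (s : V → Fin q) :
    hamiltonian Γ J n (fun x => s x.1) =
      -J * ∑ y ∈ (Γ.ballFinset n).erase Γ.root, if s (Γ.parent y) = s y then 1 else 0 := by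
  unfold hamiltonian
  congr 1
  symm
  have hball : ∀ y ∈ (Γ.ballFinset n).erase Γ.root, y ∈ Γ.ball n ∧ Γ.parent y ∈ Γ.ball n := by
    intro y hy
    rw [Finset.mem_erase, mem_ballFinset] at hy
    have := dist_parent hy.1
    exact ⟨hy.2, show _ ≤ n by omega⟩
  refine Finset.sum_bij (fun y hy => s(⟨Γ.parent y, (hball y hy).2⟩, ⟨y, (hball y hy).1⟩)) ?_ ?_ ?_ ?_
  · intro y hy
    rw [SimpleGraph.mem_edgeFinset, SimpleGraph.mem_edgeSet, SimpleGraph.comap_adj]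
    exact parent_adj (Finset.mem_erase.1 hy).1
  · intro y hy y' hy' h
    simp only [Sym2.eq_iff, Subtype.mk.injEq] at h
    rcases h with h | h
    · exact h.2
    · have h1 := dist_parent (Finset.mem_erase.1 hy).1
      have h2 := dist_parent (Finset.mem_erase.1 hy').1
      rw [h.1] at h1
      rw [← h.2] at h2
      omega
  · intro e
    induction e with
    | _ x y =>
    intro he
    rw [SimpleGraph.mem_edgeFinset, SimpleGraph.mem_edgeSet, SimpleGraph.comap_adj] at he
    rcases adj_iff.1 he with ⟨h, h'⟩ | ⟨h, h'⟩
    · refine ⟨y.1, Finset.mem_erase.2 ⟨h, mem_ballFinset.2 y.2⟩, ?_⟩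
      simp only [Sym2.eq_iff]
      exact Or.inl ⟨Subtype.ext h', trivial⟩
    · refine ⟨x.1, Finset.mem_erase.2 ⟨h, mem_ballFinset.2 x.2⟩, ?_⟩
      simp only [Sym2.eq_iff]
      exact Or.inr ⟨Subtype.ext h', trivial⟩
  · intro y hy
    simp [Sym2.map_mk, Sym2.mk_isDiag_iff]

/-- The Boltzmann factor of an edge with the spins `i` and `j` at its endpoints. -/
noncomputable def bond (J T : ℝ) (i j : Fin q) : ℝ := if i = j then Real.exp (J / T) else 1

theorem bond_pos (J T : ℝ) (i j : Fin q) : 0 < bond J T i j := by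
  unfold bond; split_ifs <;> positivity

theorem sum_bond_mul (J T : ℝ) (i : Fin q) (z : Fin q → ℝ) :
    ∑ j, bond J T i j * z j = (Real.exp (J / T) - 1) * z i + ∑ j, z j := by
  have : ∀ j, bond J T i j * z j = (if i = j then (Real.exp (J / T) - 1) * z j else 0) + z j := by
    intro j; unfold bond; split_ifs <;> ring
  simp [this, Finset.sum_add_distrib]

theorem weight_restrict (J T : ℝ) (h : V → Fin q → ℝ) (n : ℕ) (s : V → Fin q) :
    weight Γ J T h n (fun x => s x.1) =
      (∏ y ∈ (Γ.ballFinset n).erase Γ.root, bond J T (s (Γ.parent y)) (s y)) *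
        ∏ x ∈ Γ.sphereFinset n, Real.exp (h x (s x)) := by
  rw [weight, Real.exp_add, hamiltonian_restrict]
  congr 1
  · rw [show ∀ S : ℝ, -(1 / T) * (-J * S) = J / T * S by intro S; ring, Finset.mul_sum,
      Real.exp_sum]
    refine Finset.prod_congr rfl fun y _ => ?_
    unfold bond
    split_ifs <;> simp
  · rw [Real.exp_sum]
    refine Finset.prod_bij (fun x _ => x.1) ?_ ?_ ?_ ?_
    · intro x hx
      rw [Finset.mem_filter] at hx
      exact mem_sphereFinset.2 hx.2
    · intro x _ y _ h; exact Subtype.ext h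
    · intro x hx
      rw [mem_sphereFinset] at hx
      exact ⟨⟨x, show _ ≤ n from hx.le⟩, by simpa using show x ∈ Γ.sphere n from hx, rfl⟩
    · intro x _; rfl

theorem weight_pos (J T : ℝ) (h : V → Fin q → ℝ) (n : ℕ) (σ : Γ.ball n → Fin q) :
    0 < weight Γ J T h n σ := Real.exp_pos _

/-- Summing out the spins on `W_{n+1}`, which are independent given those on `V_n`. -/
theorem sum_weight_concat (J T : ℝ) (h : V → Fin q → ℝ) (n : ℕ) (s : V → Fin q) :
    ∑ ω : Γ.sphere (n + 1) → Fin q, weight Γ J T h (n + 1) (Γ.concat (fun x => s x.1) ω) =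
      (∏ y ∈ (Γ.ballFinset n).erase Γ.root, bond J T (s (Γ.parent y)) (s y)) *
        ∏ y ∈ Γ.sphereFinset (n + 1), ∑ j, bond J T (s (Γ.parent y)) j * Real.exp (h y j) := by
  have hterm : ∀ ω : Γ.sphere (n + 1) → Fin q,
      weight Γ J T h (n + 1) (Γ.concat (fun x => s x.1) ω) =
        (∏ y ∈ (Γ.ballFinset n).erase Γ.root, bond J T (s (Γ.parent y)) (s y)) *
          ∏ y : Γ.sphere (n + 1), bond J T (s (Γ.parent y.1)) (ω y) * Real.exp (h y.1 (ω y)) := by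
    intro ω
    have hin : ∀ x, Γ.graph.dist Γ.root x ≤ n → glue s ω x = s x := fun x hx =>
      dif_neg fun hx' => absurd (show Γ.graph.dist Γ.root x = n + 1 from hx') (by omega)
    rw [concat_restrict, weight_restrict, prod_ballFinset_succ, mul_assoc,
      ← Finset.prod_mul_distrib]
    congr 1
    · refine Finset.prod_congr rfl fun y hy => ?_
      rw [Finset.mem_erase, mem_ballFinset] at hy
      have := dist_parent hy.1
      rw [hin _ hy.2, hin _ (by omega)]
    · symm
      refine Finset.prod_bij (fun y _ => y.1) ?_ ?_ ?_ ?_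
      · intro y _; exact mem_sphereFinset.2 y.2
      · intro y _ y' _ h; exact Subtype.ext h
      · intro y hy; exact ⟨⟨y, mem_sphereFinset.1 hy⟩, Finset.mem_univ _, rfl⟩
      · intro y _
        have h1 : glue s ω y.1 = ω y := dif_pos y.2
        have h2 := parent_mem_sphereFinset (mem_sphereFinset.2 y.2)
        rw [h1, hin _ (mem_sphereFinset.1 h2).le]
  simp only [hterm]
  rw [← Finset.mul_sum]
  congr 1
  have := Fintype.prod_sum (ι := Γ.sphere (n + 1)) (κ := fun _ => Fin q)
    (fun y j => bond J T (s (Γ.parent y.1)) j * Real.exp (h y.1 j))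
  rw [← this]
  refine Finset.prod_bij (fun y _ => y.1) ?_ ?_ ?_ ?_
  · intro y _; exact mem_sphereFinset.2 y.2
  · intro y _ y' _ h; exact Subtype.ext h
  · intro y hy; exact ⟨⟨y, mem_sphereFinset.1 hy⟩, Finset.mem_univ _, rfl⟩
  · intro y _; rfl

end Potts

/-! ### Splitting Gibbs measures and boundary laws -/

namespace Potts

open CayleyTree MeasureTheory
open scoped Classical

variable {k q n : ℕ} {V : Type*} {Γ : CayleyTree k V}

theorem exists_extension (σ : Γ.ball n → Fin q) :
    ∃ s : V → Fin q, (fun x : Γ.ball n => s x.1) = σ := by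
  have hroot : Γ.root ∈ Γ.ball n := by simp [ball]
  refine ⟨fun x => if hx : x ∈ Γ.ball n then σ ⟨x, hx⟩ else σ ⟨Γ.root, hroot⟩, ?_⟩
  funext x
  exact dif_pos x.2

theorem measurable_restrict_ball :
    Measurable fun (ω : V → Fin q) (x : Γ.ball n) => ω x.1 :=
  measurable_pi_lambda _ fun x => measurable_pi_apply x.1

theorem preimage_restrict_ball (σ : Γ.ball n → Fin q) :
    (fun (ω : V → Fin q) (x : Γ.ball n) => ω x.1) ⁻¹' {σ} = {ω | ∀ x : Γ.ball n, ω x.1 = σ x} := by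
  ext ω
  simp [funext_iff]

theorem measurableSet_cylinder (σ : Γ.ball n → Fin q) :
    MeasurableSet {ω : V → Fin q | ∀ x : Γ.ball n, ω x.1 = σ x} := by
  rw [← preimage_restrict_ball]
  exact measurable_restrict_ball (measurableSet_singleton σ)

/-- Compatibility and the normalization come for free once the `μ_n` are, up to factors, the
marginals of a probability measure. -/
theorem isSplittingGibbs_of_proportional {J T : ℝ} {h : V → Fin q → ℝ}
    {μ : Measure (V → Fin q)} [IsProbabilityMeasure μ] (C : ℕ → ℝ)
    (hμ : ∀ n (σ : Γ.ball n → Fin q),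
      μ.real {ω | ∀ x : Γ.ball n, ω x.1 = σ x} = C n * weight Γ J T h n σ) :
    IsSplittingGibbs Γ J T h μ := by
  have hsum : ∀ n (S : Finset (Γ.ball n → Fin q)),
      ∑ σ ∈ S, μ.real {ω | ∀ x : Γ.ball n, ω x.1 = σ x} =
        μ.real ((fun (ω : V → Fin q) (x : Γ.ball n) => ω x.1) ⁻¹' S) := by
    intro n S
    rw [← sum_measureReal_preimage_singleton S fun σ _ =>
      measurable_restrict_ball (measurableSet_singleton σ)]
    simp only [preimage_restrict_ball]
  have hmarg : ∀ n (σ : Γ.ball n → Fin q),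
      μ.real {ω | ∀ x : Γ.ball n, ω x.1 = σ x} = finiteDist Γ J T h n σ := by
    intro n σ
    have h1 := hsum n Finset.univ
    simp only [hμ, Finset.coe_univ, Set.preimage_univ, probReal_univ, ← Finset.mul_sum] at h1
    rw [finiteDist, hμ, eq_div_iff (right_ne_zero_of_mul_eq_one h1)]
    linear_combination weight Γ J T h n σ * h1
  refine ⟨inferInstance, fun n σ => ?_, hmarg⟩
  simp only [← hmarg]
  have hinj : Function.Injective (Γ.concat (q := q) σ) := by
    intro ω ω' hω
    funext x
    have hx : ¬ Γ.graph.dist Γ.root x.1 ≤ n := by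
      have : Γ.graph.dist Γ.root x.1 = n + 1 := x.2
      omega
    have := congrFun hω ⟨x.1, Γ.sphere_subset_ball _ x.2⟩
    simpa [concat, hx] using this
  rw [← Finset.sum_image (f := fun τ => μ.real {ω | ∀ x : Γ.ball (n + 1), ω x.1 = τ x})
    hinj.injOn, hsum]
  congr 1
  ext ω
  simp only [Finset.coe_image, Finset.coe_univ, Set.image_univ, Set.mem_preimage, Set.mem_range,
    Set.mem_ofPred_eq]
  constructor
  · rintro ⟨τ, hτ⟩ x
    have := congrFun hτ ⟨x.1, Nat.le_succ_of_le x.2⟩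
    have hx : Γ.graph.dist Γ.root x.1 ≤ n := x.2
    simp only [concat, hx, dif_pos] at this
    exact this.symm
  · intro hω
    refine ⟨fun x => ω x.1, funext fun x => ?_⟩
    unfold concat
    split_ifs with hx
    · exact (hω ⟨x.1, hx⟩).symm
    · rfl

/-- The spin at `x` of the Markov chain on the tree: the coordinate `ω (x, i)` is the spin that `x`
takes if its parent has the spin `i`. The recursion is on the distance to the root, whose own spin
is `ω (Γ.root, i₀)`. -/
noncomputable def spinAux (Γ : CayleyTree k V) (i₀ : Fin q) (ω : V × Fin q → Fin q) :
    ℕ → V → Fin q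
  | 0, x => ω (x, i₀)
  | n + 1, x => ω (x, spinAux Γ i₀ ω n (Γ.parent x))

/-- `spinAux` run for as many steps as `x` is away from the root. -/
noncomputable def spin (Γ : CayleyTree k V) (i₀ : Fin q) (ω : V × Fin q → Fin q) (x : V) : Fin q :=
  spinAux Γ i₀ ω (Γ.graph.dist Γ.root x) x

theorem spin_root (i₀ : Fin q) (ω : V × Fin q → Fin q) :
    spin Γ i₀ ω Γ.root = ω (Γ.root, i₀) := by
  simp [spin, spinAux]

theorem spin_of_ne_root (i₀ : Fin q) (ω : V × Fin q → Fin q) {x : V} (hx : x ≠ Γ.root) :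
    spin Γ i₀ ω x = ω (x, spin Γ i₀ ω (Γ.parent x)) := by
  rw [spin, ← dist_parent hx, spinAux, spin]

theorem measurable_spin (i₀ : Fin q) : Measurable (spin Γ i₀) := by
  refine measurable_pi_lambda _ fun x => ?_
  suffices ∀ n x, Measurable fun ω => spinAux Γ i₀ ω n x from this _ x
  intro n
  induction n with
  | zero => exact fun x => measurable_pi_apply (x, i₀)
  | succ n ih =>
    intro x
    refine measurable_to_countable' fun j => ?_
    have : (fun ω => spinAux Γ i₀ ω (n + 1) x) ⁻¹' {j} =
        ⋃ i, ((fun ω => spinAux Γ i₀ ω n (Γ.parent x)) ⁻¹' {i} ∩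
          (fun ω : V × Fin q → Fin q => ω (x, i)) ⁻¹' {j}) := by
      ext ω
      simp [spinAux]
    rw [this]
    exact MeasurableSet.iUnion fun i => (ih _ (measurableSet_singleton i)).inter
      (measurable_pi_apply (x, i) (measurableSet_singleton j))

/-- In terms of the independent coordinates, a cylinder over `V_n` is a box with one coordinate for
each vertex. -/
theorem forall_spin_eq_iff (i₀ : Fin q) (ω : V × Fin q → Fin q) (s : V → Fin q) :
    (∀ x ∈ Γ.ballFinset n, spin Γ i₀ ω x = s x) ↔
      ∀ x ∈ Γ.ballFinset n, ω (x, if x = Γ.root then i₀ else s (Γ.parent x)) = s x := by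
  constructor
  · intro h x hx
    rw [← h x hx]
    split_ifs with hx0
    · rw [hx0, spin_root]
    · have := dist_parent hx0
      rw [mem_ballFinset] at hx
      rw [spin_of_ne_root i₀ ω hx0, h _ (mem_ballFinset.2 (by omega))]
  · intro h
    suffices ∀ d, ∀ x ∈ Γ.ballFinset n, Γ.graph.dist Γ.root x = d → spin Γ i₀ ω x = s x from
      fun x hx => this _ x hx rfl
    intro d
    induction d with
    | zero =>
      intro x hx hd
      have hx0 := dist_root_eq_zero_iff.1 hd
      rw [← h x hx, if_pos hx0, hx0, spin_root]
    | succ d ih =>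
      intro x hx hd
      have hx0 : x ≠ Γ.root := by rintro rfl; simp at hd
      have hp := dist_parent hx0
      rw [mem_ballFinset] at hx
      rw [← h x (mem_ballFinset.2 hx), if_neg hx0, spin_of_ne_root i₀ ω hx0,
        ih _ (mem_ballFinset.2 (by omega)) (by omega)]

/-- The tree-indexed Markov chain with initial law `r` and transition matrix `p`. -/
theorem exists_markovChain (Γ : CayleyTree k V) (r : Fin q → ℝ) (p : Fin q → Fin q → ℝ)
    (hr : ∀ j, 0 ≤ r j) (hr1 : ∑ j, r j = 1) (hp : ∀ i j, 0 ≤ p i j) (hp1 : ∀ i, ∑ j, p i j = 1) :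
    ∃ μ : Measure (V → Fin q), IsProbabilityMeasure μ ∧ ∀ n (s : V → Fin q),
      μ.real {ω | ∀ x : Γ.ball n, ω x.1 = s x.1} =
        r (s Γ.root) * ∏ y ∈ (Γ.ballFinset n).erase Γ.root, p (s (Γ.parent y)) (s y) := by
  obtain ⟨i₀⟩ : Nonempty (Fin q) := by
    by_contra h
    rw [not_nonempty_iff] at h
    simp at hr1
  let K : V × Fin q → Fin q → ℝ := fun a => if a.1 = Γ.root then r else p a.2
  have hK : ∀ a j, 0 ≤ K a j := by intro a j; simp only [K]; split_ifs <;> simp [hr, hp]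
  have hK1 : ∀ a, ∑ j, K a j = 1 := by intro a; simp only [K]; split_ifs <;> simp [hr1, hp1]
  let ν : V × Fin q → Measure (Fin q) := fun a => ∑ j, ENNReal.ofReal (K a j) • Measure.dirac j
  have hν : ∀ a j, ν a {j} = ENNReal.ofReal (K a j) := by
    intro a j
    simp [ν, Measure.finsetSum_apply, Set.indicator_apply]
  have hprob : ∀ a, IsProbabilityMeasure (ν a) := by
    intro a
    constructor
    simp only [ν, Measure.finsetSum_apply, Measure.smul_apply, measure_univ, smul_eq_mul, mul_one]
    rw [← ENNReal.ofReal_sum_of_nonneg fun j _ => hK a j, hK1, ENNReal.ofReal_one]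
  refine ⟨(Measure.infinitePi ν).map (spin Γ i₀),
    Measure.isProbabilityMeasure_map (measurable_spin i₀).aemeasurable, fun n s => ?_⟩
  let key : V → V × Fin q := fun x => (x, if x = Γ.root then i₀ else s (Γ.parent x))
  have hkey : Function.Injective key := fun x y h => congrArg Prod.fst h
  have hset : spin Γ i₀ ⁻¹' {ω | ∀ x : Γ.ball n, ω x.1 = s x.1} =
      Set.pi (((Γ.ballFinset n).image key : Finset (V × Fin q)) : Set (V × Fin q))
        fun a => {s a.1} := by
    ext ω
    have := forall_spin_eq_iff (Γ := Γ) (n := n) i₀ ω s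
    simpa [Set.mem_pi, ball, key] using this
  have hroot : Γ.root ∈ Γ.ballFinset n := by simp
  rw [map_measureReal_apply (measurable_spin i₀) (measurableSet_cylinder _), hset, measureReal_def,
    Measure.infinitePi_pi _ fun a _ => measurableSet_singleton _, ENNReal.toReal_prod,
    Finset.prod_image hkey.injOn, ← Finset.mul_prod_erase _ _ hroot]
  congr 1
  · simp [hν, key, K, hr]
  · refine Finset.prod_congr rfl fun y hy => ?_
    simp [hν, key, K, (Finset.mem_erase.1 hy).1, hp]

/-- The cylinders over the balls `V_n`, `n ≥ 1`, determine a probability measure. -/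
theorem measure_ext_of_cylinder {μ ν : Measure (V → Fin q)} [IsProbabilityMeasure μ]
    [IsProbabilityMeasure ν] (h : ∀ n, 1 ≤ n → ∀ σ : Γ.ball n → Fin q,
      μ.real {ω | ∀ x : Γ.ball n, ω x.1 = σ x} = ν.real {ω | ∀ x : Γ.ball n, ω x.1 = σ x}) :
    μ = ν := by
  have hprob : ∀ I : Finset V, IsFiniteMeasure (ν.map I.restrict) := fun I => inferInstance
  refine IsProjectiveLimit.unique (P := fun I => ν.map I.restrict) (fun I => ?_) fun I => rfl
  -- the successor makes the radius positive, as `μ_0` is not compared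
  let n := I.sup (fun x => Γ.graph.dist Γ.root x) + 1
  have hI : ∀ x ∈ I, x ∈ Γ.ball n := fun x hx =>
    (Finset.le_sup (f := fun x => Γ.graph.dist Γ.root x) hx).trans (Nat.le_succ _)
  have hball : μ.map (fun ω (x : Γ.ball n) => ω x.1) = ν.map fun ω (x : Γ.ball n) => ω x.1 := by
    refine Measure.ext_of_singleton fun σ => ?_
    rw [Measure.map_apply measurable_restrict_ball (measurableSet_singleton σ),
      Measure.map_apply measurable_restrict_ball (measurableSet_singleton σ),
      preimage_restrict_ball]
    exact (ENNReal.toReal_eq_toReal_iff' (measure_ne_top _ _) (measure_ne_top _ _)).1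
      (h n (Nat.le_add_left _ _) σ)
  have hcomp : I.restrict (π := fun _ => Fin q) =
      (fun (τ : Γ.ball n → Fin q) (x : I) => τ ⟨x.1, hI x.1 x.2⟩) ∘
        fun ω (x : Γ.ball n) => ω x.1 := rfl
  have hmeas : Measurable fun (τ : Γ.ball n → Fin q) (x : I) => τ ⟨x.1, hI x.1 x.2⟩ :=
    measurable_pi_lambda _ fun x => measurable_pi_apply _
  rw [hcomp, ← Measure.map_map hmeas measurable_restrict_ball, hball,
    Measure.map_map hmeas measurable_restrict_ball]
  rfl

theorem finiteDist_congr {J T : ℝ} {h h' : V → Fin q → ℝ}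
    (hh : ∀ x ∈ Γ.sphereFinset n, ∀ i j, h x i - h x j = h' x i - h' x j)
    (σ : Γ.ball n → Fin q) : finiteDist Γ J T h n σ = finiteDist Γ J T h' n σ := by
  obtain ⟨i₀⟩ : Nonempty (Fin q) := ⟨σ ⟨Γ.root, by simp [ball]⟩⟩
  let C : ℝ := ∏ x ∈ Γ.sphereFinset n, Real.exp (h x i₀ - h' x i₀)
  have hC : 0 < C := Finset.prod_pos fun _ _ => Real.exp_pos _
  have hw : ∀ τ, weight Γ J T h n τ = C * weight Γ J T h' n τ := by
    intro τ
    obtain ⟨s, rfl⟩ := exists_extension τ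
    rw [weight_restrict, weight_restrict, mul_left_comm, ← Finset.prod_mul_distrib]
    congr 1
    refine Finset.prod_congr rfl fun x hx => ?_
    rw [← Real.exp_add]
    congr 1
    linarith [hh x hx (s x) i₀]
  simp only [finiteDist, hw, ← Finset.mul_sum]
  exact mul_div_mul_left _ _ hC.ne'

/-- The boundary field of the boundary law `y`, in the normalization of `fixedPoints`. The exponent
at the root differs because the root has one successor more. -/
noncomputable def boundaryField (Γ : CayleyTree k V) (y : Fin q → ℝ) : V → Fin q → ℝ :=
  fun x i => (if x = Γ.root then (k + 1 : ℕ) else k : ℕ) * Real.log (y i)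

theorem isTranslationInvariantField_boundaryField (y : Fin q → ℝ) :
    IsTranslationInvariantField Γ (boundaryField Γ y) :=
  ⟨fun i => k * Real.log (y i), fun x hx i j => by simp [boundaryField, hx]⟩

theorem exp_boundaryField {y : Fin q → ℝ} (hy : ∀ i, 1 ≤ y i) (x : V) (i : Fin q) :
    Real.exp (boundaryField Γ y x i) = y i ^ (if x = Γ.root then k + 1 else k) := by
  have hpos : 0 < y i := one_pos.trans_le (hy i)
  rw [boundaryField, Real.exp_nat_mul, Real.exp_log hpos]

/-- The measure is the Markov chain with initial law proportional to `y j ^ (k + 1)` and transition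
probabilities proportional to `bond i j * y j ^ k`. By the fixed point equation the normalization of
the row `i` is a multiple of `y i`, so the normalizations over the `k` successors of a vertex cancel
its factor `y i ^ k`, and over the `k + 1` successors of the root the factor `y i ^ (k + 1)`. -/
theorem exists_isSplittingGibbs (Γ : CayleyTree k V) {J T : ℝ} {y : Fin q → ℝ}
    (hc : 0 < Real.exp (J / T) - 1) (hy : y ∈ fixedPoints k q (Real.exp (J / T) - 1)) :
    ∃ μ, IsSplittingGibbs Γ J T (boundaryField Γ y) μ := by
  obtain ⟨hy1, ⟨b, -⟩, hfix⟩ := hy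
  have hpos : ∀ i, 0 < y i := fun i => one_pos.trans_le (hy1 i)
  have : Nonempty (Fin q) := ⟨b⟩
  set A : ℝ := Real.exp (J / T) - 1 + ∑ j, y j ^ k with hA
  have hApos : 0 < A := add_pos hc (Finset.sum_pos (fun j _ => pow_pos (hpos j) _)
    Finset.univ_nonempty)
  set R : ℝ := ∑ j, y j ^ (k + 1) with hR
  have hRpos : 0 < R := Finset.sum_pos (fun j _ => pow_pos (hpos j) _) Finset.univ_nonempty
  obtain ⟨μ, hμ, hcyl⟩ := exists_markovChain Γ (fun j => y j ^ (k + 1) / R)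
    (fun i j => bond J T i j * y j ^ k / (A * y i))
    (fun j => (div_pos (pow_pos (hpos j) _) hRpos).le)
    (by rw [← Finset.sum_div, div_self hRpos.ne'])
    (fun i j => (div_pos (mul_pos (bond_pos _ _ _ _) (pow_pos (hpos j) _))
      (mul_pos hApos (hpos i))).le)
    (fun i => by
      rw [← Finset.sum_div, sum_bond_mul, hfix i, div_self (mul_pos hApos (hpos i)).ne'])
  refine ⟨μ, isSplittingGibbs_of_proportional
    (fun n => R⁻¹ * ∏ y ∈ (Γ.ballFinset n).erase Γ.root, A⁻¹) fun n σ => ?_⟩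
  obtain ⟨s, rfl⟩ := exists_extension σ
  rw [hcyl, weight_restrict]
  induction n with
  | zero =>
    have h0 : (Γ.ballFinset 0).erase Γ.root = ∅ := by
      ext x
      simp only [Finset.mem_erase, mem_ballFinset, nonpos_iff_eq_zero, dist_root_eq_zero_iff]
      simp
    have h1 : Γ.sphereFinset 0 = {Γ.root} := by
      ext x
      rw [mem_sphereFinset, dist_root_eq_zero_iff, Finset.mem_singleton]
    rw [h0, h1, Finset.prod_singleton, exp_boundaryField hy1]
    simp [div_eq_inv_mul]
  | succ n ih =>
    have hsph : ∏ x ∈ Γ.sphereFinset n, Real.exp (boundaryField Γ y x (s x)) =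
        ∏ x ∈ Γ.sphereFinset (n + 1), y (s (Γ.parent x)) := by
      rw [prod_parent (fun x => y (s x))]
      refine Finset.prod_congr rfl fun x hx => ?_
      rw [exp_boundaryField hy1]
      congr 1
      rw [mem_sphereFinset] at hx
      by_cases hn : n = 0
      · rw [if_pos hn, if_pos (dist_root_eq_zero_iff.1 (hx.trans hn))]
      · rw [if_neg hn, if_neg fun h => hn (hx.symm.trans (dist_root_eq_zero_iff.2 h))]
    rw [prod_ballFinset_succ, prod_ballFinset_succ, prod_ballFinset_succ, ← mul_assoc, ih, hsph]
    have hstep : (∏ x ∈ Γ.sphereFinset (n + 1), y (s (Γ.parent x))) *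
        ∏ x ∈ Γ.sphereFinset (n + 1),
          (bond J T (s (Γ.parent x)) (s x) * y (s x) ^ k / (A * y (s (Γ.parent x)))) =
        (∏ x ∈ Γ.sphereFinset (n + 1), A⁻¹) *
          ((∏ x ∈ Γ.sphereFinset (n + 1), bond J T (s (Γ.parent x)) (s x)) *
            ∏ x ∈ Γ.sphereFinset (n + 1), Real.exp (boundaryField Γ y x (s x))) := by
      simp only [← Finset.prod_mul_distrib]
      refine Finset.prod_congr rfl fun x hx => ?_
      rw [exp_boundaryField hy1, if_neg (ne_root_of_mem_sphereFinset hx)]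
      have := (hpos (s (Γ.parent x))).ne'
      field_simp
    linear_combination (R⁻¹ * (∏ y ∈ (Γ.ballFinset n).erase Γ.root, A⁻¹) *
      ∏ y ∈ (Γ.ballFinset n).erase Γ.root, bond J T (s (Γ.parent y)) (s y)) * hstep

theorem exists_exp_field_eq {h : V → Fin q → ℝ} {h₀ : Fin q → ℝ}
    (hh : ∀ x, x ≠ Γ.root → ∀ i j, h x i - h x j = h₀ i - h₀ j) (i₀ : Fin q) :
    ∃ a : V → ℝ, (∀ x, 0 < a x) ∧ ∀ x ≠ Γ.root, ∀ i, Real.exp (h x i) = a x * Real.exp (h₀ i) := by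
  refine ⟨fun x => Real.exp (h x i₀ - h₀ i₀), fun x => Real.exp_pos _, fun x hx i => ?_⟩
  rw [← Real.exp_add]
  congr 1
  linarith [hh x hx i i₀]

/-- The weight of a constant configuration on `V_1` depends on its spin `i` only through
`exp (h₀ i)`, since its edges carry equal spins and the root does not lie on `W_1`. -/
theorem weight_one_const {J T : ℝ} {h : V → Fin q → ℝ} {h₀ : Fin q → ℝ}
    (hh : ∀ x, x ≠ Γ.root → ∀ i j, h x i - h x j = h₀ i - h₀ j) :
    ∃ C, 0 < C ∧ ∀ i, weight Γ J T h 1 (fun _ => i) =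
      C * Real.exp (h₀ i) ^ (Γ.sphereFinset 1).card := by
  rcases isEmpty_or_nonempty (Fin q) with hq | ⟨⟨i₀⟩⟩
  · exact ⟨1, one_pos, fun i => isEmptyElim i⟩
  obtain ⟨a, ha, hexp⟩ := exists_exp_field_eq hh i₀
  refine ⟨(∏ y ∈ (Γ.ballFinset 1).erase Γ.root, Real.exp (J / T)) *
    ∏ x ∈ Γ.sphereFinset 1, a x, mul_pos (Finset.prod_pos fun _ _ => Real.exp_pos _)
      (Finset.prod_pos fun x _ => ha x), fun i => ?_⟩
  rw [weight_restrict J T h 1 fun _ => i, mul_assoc, ← Finset.prod_const, ← Finset.prod_mul_distrib]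
  simp only [bond, if_true]
  congr 1
  exact Finset.prod_congr rfl fun x hx => hexp x (ne_root_of_mem_sphereFinset hx) i

/-- Compatibility of `μ_2` with `μ_1`, evaluated at constant configurations, gives the fixed point
equation. -/
theorem exists_fixedPoint_of_compatible (hk : 2 ≤ k) (hq : 1 ≤ q) {J T : ℝ}
    (hc : 0 < Real.exp (J / T) - 1) {h : V → Fin q → ℝ} {h₀ : Fin q → ℝ}
    (hh : ∀ x, x ≠ Γ.root → ∀ i j, h x i - h x j = h₀ i - h₀ j) (hcomp : Compatible Γ J T h) :
    ∃ y ∈ fixedPoints k q (Real.exp (J / T) - 1),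
      ∀ i j, k * Real.log (y i) - k * Real.log (y j) = h₀ i - h₀ j := by
  have hne : Nonempty (Fin q) := ⟨⟨0, hq⟩⟩
  let i₀ : Fin q := ⟨0, hq⟩
  set c : ℝ := Real.exp (J / T) - 1 with hc'
  let z : Fin q → ℝ := fun i => Real.exp (h₀ i)
  have hz : ∀ i, 0 < z i := fun i => Real.exp_pos _
  let ζ : Fin q → ℝ := fun i => c * z i + ∑ j, z j
  have hζ : ∀ i, 0 < ζ i := fun i => add_pos_of_pos_of_nonneg (mul_pos hc (hz i))
    (Finset.sum_nonneg fun j _ => (hz j).le)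
  set N := (Γ.sphereFinset 1).card with hN
  have hN0 : N ≠ 0 := (Finset.card_pos.2 (sphereFinset_nonempty 1 (by omega))).ne'
  obtain ⟨a, ha, hexp⟩ := exists_exp_field_eq hh i₀
  obtain ⟨C, hC, hw⟩ := weight_one_const (J := J) (T := T) hh
  have hsum : ∀ i, ∑ ω : Γ.sphere 2 → Fin q, weight Γ J T h 2 (Γ.concat (n := 1) (fun _ => i) ω) =
      ((∏ y ∈ (Γ.ballFinset 1).erase Γ.root, Real.exp (J / T)) * ∏ x ∈ Γ.sphereFinset 2, a x) *
        (ζ i ^ k) ^ N := by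
    intro i
    rw [sum_weight_concat J T h 1 fun _ => i, mul_assoc]
    congr 1
    · simp [bond]
    · have h1 : (ζ i ^ k) ^ N = ∏ y ∈ Γ.sphereFinset (1 + 1), ζ i := by
        rw [prod_parent (n := 1) (fun _ => ζ i), Finset.prod_const, if_neg one_ne_zero]
      rw [h1, ← Finset.prod_mul_distrib]
      refine Finset.prod_congr rfl fun x hx => ?_
      have h2 : ∀ j, bond J T i j * Real.exp (h x j) = a x * (bond J T i j * z j) := by
        intro j
        rw [hexp x (ne_root_of_mem_sphereFinset hx) j]; ring
      simp only [h2]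
      rw [← Finset.mul_sum, sum_bond_mul]
  obtain ⟨D, hD⟩ : ∃ D : ℝ, ∀ i, (ζ i ^ k / z i) ^ N = D := by
    let B : ℝ := (∏ y ∈ (Γ.ballFinset 1).erase Γ.root, Real.exp (J / T)) *
      ∏ x ∈ Γ.sphereFinset 2, a x
    have hB : 0 < B := mul_pos (Finset.prod_pos fun _ _ => Real.exp_pos _)
      (Finset.prod_pos fun x _ => ha x)
    have hZ : ∀ n, 0 < ∑ τ : Γ.ball n → Fin q, weight Γ J T h n τ := fun n =>
      Finset.sum_pos (fun τ _ => weight_pos J T h n τ) ⟨fun _ => i₀, Finset.mem_univ _⟩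
    refine ⟨C / (∑ τ : Γ.ball 1 → Fin q, weight Γ J T h 1 τ) /
      (B / ∑ τ : Γ.ball 2 → Fin q, weight Γ J T h 2 τ), fun i => ?_⟩
    have h1 := hcomp 1 fun _ => i
    simp only [finiteDist] at h1
    rw [← Finset.sum_div, hsum, hw] at h1
    have e1 := (hZ 1).ne'
    have e2 := (hZ 2).ne'
    have e3 := (pow_pos (hz i) N).ne'
    rw [div_eq_div_iff e2 e1] at h1
    rw [div_pow, div_div_div_eq, div_eq_div_iff e3 (mul_pos (hZ 1) hB).ne']
    linear_combination h1
  have hratio : ∀ i j, ζ i ^ k / z i = ζ j ^ k / z j := fun i j =>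
    (pow_left_inj₀ (div_pos (pow_pos (hζ i) k) (hz i)).le (div_pos (pow_pos (hζ j) k) (hz j)).le
      hN0).1 ((hD i).trans (hD j).symm)
  -- dividing by the smallest `ζ b` gives the normalization `min y = 1`
  obtain ⟨b, hb⟩ := Finite.exists_min z
  have hpow : ∀ i, (ζ i / ζ b) ^ k = z i / z b := by
    intro i
    have := hratio i b
    rw [div_eq_div_iff (hz i).ne' (hz b).ne'] at this
    rw [div_pow, div_eq_div_iff (pow_pos (hζ b) k).ne' (hz b).ne']
    linear_combination this
  refine ⟨fun i => ζ i / ζ b, ⟨fun i => ?_, ⟨b, div_self (hζ b).ne'⟩, fun i => ?_⟩, fun i j => ?_⟩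
  · rw [le_div_iff₀ (hζ b), one_mul]
    exact add_le_add_left (mul_le_mul_of_nonneg_left (hb i) hc.le) _
  · simp only [hpow]
    rw [← Finset.sum_div]
    have e1 := (hz b).ne'
    have e2 := (hζ b).ne'
    have e3 : c + (∑ j, z j) / z b = ζ b / z b := by
      simp only [ζ]; field_simp
    rw [e3]
    field_simp
    simp [ζ]
  · have hlog : ∀ i, k * Real.log (ζ i / ζ b) = h₀ i - h₀ b := by
      intro i
      rw [← Real.log_pow, hpow, ← Real.exp_sub, Real.log_exp]
    rw [hlog, hlog]; ring

/-- The values of `μ_1` at the constant configurations determine the field up to a constant. -/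
theorem field_eq_of_isSplittingGibbs (hk : 1 ≤ k) {J T : ℝ} {h h' : V → Fin q → ℝ}
    {h₀ h₀' : Fin q → ℝ} (hh : ∀ x, x ≠ Γ.root → ∀ i j, h x i - h x j = h₀ i - h₀ j)
    (hh' : ∀ x, x ≠ Γ.root → ∀ i j, h' x i - h' x j = h₀' i - h₀' j)
    {μ : Measure (V → Fin q)} (hμ : IsSplittingGibbs Γ J T h μ)
    (hμ' : IsSplittingGibbs Γ J T h' μ) (i j : Fin q) : h₀ i - h₀ j = h₀' i - h₀' j := by
  obtain ⟨C, hC, hw⟩ := weight_one_const (J := J) (T := T) hh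
  obtain ⟨C', hC', hw'⟩ := weight_one_const (J := J) (T := T) hh'
  have hZ : ∀ g : V → Fin q → ℝ, 0 < ∑ τ : Γ.ball 1 → Fin q, weight Γ J T g 1 τ := fun g =>
    Finset.sum_pos (fun τ _ => weight_pos J T g 1 τ) ⟨fun _ => i, Finset.mem_univ _⟩
  set N := (Γ.sphereFinset 1).card with hN
  have hN0 : N ≠ 0 := (Finset.card_pos.2 (sphereFinset_nonempty 1 hk)).ne'
  have key : ∀ l, Real.exp (h₀ l - h₀' l) ^ N =
      C' / (∑ τ : Γ.ball 1 → Fin q, weight Γ J T h' 1 τ) /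
        (C / ∑ τ : Γ.ball 1 → Fin q, weight Γ J T h 1 τ) := by
    intro l
    have h1 := (hμ.2.2 1 fun _ => l).symm.trans (hμ'.2.2 1 fun _ => l)
    rw [finiteDist, finiteDist, hw, hw', div_eq_div_iff (hZ h).ne' (hZ h').ne'] at h1
    rw [Real.exp_sub, div_pow, div_div_div_eq, div_eq_div_iff (pow_pos (Real.exp_pos _) N).ne'
      (mul_pos (hZ h') hC).ne']
    linear_combination h1
  have := (pow_left_inj₀ (Real.exp_pos _).le (Real.exp_pos _).le hN0).1
    ((key i).trans (key j).symm)
  linarith [Real.exp_injective this]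

theorem fixedPoint_eq_of_log_sub_eq (hk : 1 ≤ k) {c : ℝ} {y y' : Fin q → ℝ}
    (hy : y ∈ fixedPoints k q c) (hy' : y' ∈ fixedPoints k q c)
    (h : ∀ i j, k * Real.log (y i) - k * Real.log (y j) =
      k * Real.log (y' i) - k * Real.log (y' j)) : y = y' := by
  obtain ⟨hle, ⟨b, hb⟩, -⟩ := hy
  obtain ⟨hle', ⟨b', hb'⟩, -⟩ := hy'
  have hk0 : (0 : ℝ) < k := by exact_mod_cast hk
  have h' : ∀ i j, Real.log (y i) - Real.log (y j) = Real.log (y' i) - Real.log (y' j) := by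
    intro i j
    have := h i j
    rw [← mul_sub, ← mul_sub] at this
    exact mul_left_cancel₀ hk0.ne' this
  have h0 : Real.log (y' b) = 0 := by
    have h1 := h' b b'
    rw [hb, hb', Real.log_one] at h1
    linarith [Real.log_nonneg (hle b'), Real.log_nonneg (hle' b)]
  funext i
  have h1 := h' i b
  rw [hb, Real.log_one, h0, sub_zero, sub_zero] at h1
  exact Real.log_injOn_pos (one_pos.trans_le (hle i)) (one_pos.trans_le (hle' i)) h1

/-- The translation-invariant splitting Gibbs measures are in bijection with the normalized
boundary laws. -/
theorem encard_TISGM (hk : 2 ≤ k) (hq : 1 ≤ q) (Γ : CayleyTree k V) {J T : ℝ} (hJ : 0 < J)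
    (hT : 0 < T) :
    (TISGM Γ q J T).encard = (fixedPoints k q (Real.exp (J / T) - 1)).encard := by
  have hc : 0 < Real.exp (J / T) - 1 := sub_pos.2 (Real.one_lt_exp_iff.2 (div_pos hJ hT))
  have hex := fun y (hy : y ∈ fixedPoints k q (Real.exp (J / T) - 1)) =>
    exists_isSplittingGibbs Γ hc hy
  choose! Φ hΦ using hex
  have hfield : ∀ (y : Fin q → ℝ) (x : V), x ≠ Γ.root → ∀ i j,
      boundaryField Γ y x i - boundaryField Γ y x j =
        k * Real.log (y i) - k * Real.log (y j) := fun y x hx i j => by simp [boundaryField, hx]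
  have hinj : Set.InjOn Φ (fixedPoints k q (Real.exp (J / T) - 1)) := by
    intro y hy y' hy' h
    exact fixedPoint_eq_of_log_sub_eq (by omega) hy hy' fun i j =>
      field_eq_of_isSplittingGibbs (h₀ := fun i => k * Real.log (y i))
        (h₀' := fun i => k * Real.log (y' i)) (by omega) (hfield y) (hfield y') (hΦ y hy)
        (h ▸ hΦ y' hy') i j
  rw [← hinj.encard_image]
  congr 1
  ext μ
  constructor
  · rintro ⟨h, ⟨h₀, hh⟩, hμ⟩
    obtain ⟨y, hy, hyh⟩ := exists_fixedPoint_of_compatible hk hq hc hh hμ.2.1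
    refine ⟨y, hy, ?_⟩
    have := hμ.1
    have := (hΦ y hy).1
    refine measure_ext_of_cylinder (Γ := Γ) fun n hn σ => ?_
    rw [hμ.2.2, (hΦ y hy).2.2]
    refine finiteDist_congr (fun x hx i j => ?_) σ
    have hx0 : x ≠ Γ.root := by
      rintro rfl
      rw [mem_sphereFinset, SimpleGraph.dist_self] at hx
      omega
    rw [hfield y x hx0, hh x hx0, hyh]
  · rintro ⟨y, hy, rfl⟩
    exact ⟨boundaryField Γ y, isTranslationInvariantField_boundaryField y, hΦ y hy⟩

end Potts

/-! ### Critical values and the count -/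

namespace Potts

variable {k q : ℕ}

/-- The critical values `κ m = min ηₘ` of `exp (J / T) - 1`, and the number of ratios `r > 1` on
either side of them: below the value `q / (k - 1) = ηₘ 1`, the level `c > κ m` is attained twice on
`(1, ∞)`, from there on the lower of the two solutions is at most `1` and does not count. For
`m ≥ q / 2` the minimum of `ηₘ` on `[1, ∞)` is its value at `1`. -/
theorem exists_criticalValues (hk : 2 ≤ k) (hq : 2 ≤ q) : ∃ κ : ℕ → ℝ,
    (∀ m, 1 ≤ m → m < q → 0 < κ m) ∧
    (∀ m, 1 ≤ m → 2 * m < q → κ m < q / ((k : ℝ) - 1)) ∧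
    (∀ m, q ≤ 2 * m → m < q → κ m = q / ((k : ℝ) - 1)) ∧
    (∀ m, 1 ≤ m → m + 1 ≤ q / 2 → κ m < κ (m + 1)) ∧
    ∀ (c : ℝ) (m : ℕ), 1 ≤ m → m < q →
      {r | 1 < r ∧ ratioCurve k q m r = c}.encard =
        ((if κ m < c ∧ c < q / ((k : ℝ) - 1) then 1 else 0) + (if κ m < c then 1 else 0) +
          (if κ m = c ∧ c < q / ((k : ℝ) - 1) then 1 else 0) : ℕ) := by
  have hex : ∀ m : ℕ, ∃ a : ℝ, 1 ≤ m → m < q → 1 ≤ a ∧ (2 * m < q → 1 < a) ∧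
      (q ≤ 2 * m → a = 1) ∧ StrictAntiOn (ratioCurve k q m) (Set.Icc 1 a) ∧
      StrictMonoOn (ratioCurve k q m) (Set.Ici a) := by
    intro m
    by_cases hm : 1 ≤ m ∧ m < q
    · obtain ⟨a, h1, h2, h3, h4⟩ := exists_ratioCurve_unimodal (k := k) (q := (q : ℝ)) (m := m) hk
        (by exact_mod_cast hm.1) (by exact_mod_cast hm.2)
      exact ⟨a, fun _ _ => ⟨h1, fun h => h2 (by exact_mod_cast h),
        fun h => h3 (by exact_mod_cast h), h4⟩⟩
    · exact ⟨0, fun h1 h2 => absurd ⟨h1, h2⟩ hm⟩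
  choose a ha using hex
  have hle : ∀ m, 1 ≤ m → m < q → ∀ x, 1 ≤ x → x ≠ a m →
      ratioCurve k q m (a m) < ratioCurve k q m x := by
    intro m h1 h2 x hx hxa
    obtain ⟨ha1, -, -, hanti, hmono⟩ := ha m h1 h2
    rcases lt_or_gt_of_ne hxa with h | h
    · exact hanti ⟨hx, h.le⟩ ⟨ha1, le_rfl⟩ h
    · exact hmono Set.self_mem_Ici h.le h
  have hlt : ∀ m, 1 ≤ m → 2 * m < q → ratioCurve k q m (a m) < q / ((k : ℝ) - 1) := by
    intro m h1 h2
    rw [← ratioCurve_one (m := m) hk]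
    exact hle m h1 (by omega) 1 le_rfl ((ha m h1 (by omega)).2.1 h2).ne
  have heq : ∀ m, q ≤ 2 * m → m < q → ratioCurve k q m (a m) = q / ((k : ℝ) - 1) := by
    intro m h1 h2
    rw [(ha m (by omega) h2).2.2.1 h1, ratioCurve_one hk]
  refine ⟨fun m => ratioCurve k q m (a m), ?_, hlt, heq, ?_, ?_⟩
  · intro m h1 h2
    have ha0 : 0 < a m := one_pos.trans_le (ha m h1 h2).1
    have hqm : (0 : ℝ) < q - m := sub_pos.2 (by exact_mod_cast h2)
    have := geom_denom_pos hk ha0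
    exact div_pos (by positivity) this
  · intro m h1 h2
    have hb := (ha (m + 1) (by omega) (by omega)).1
    have hstep : ∀ x : ℝ, 1 ≤ x → ratioCurve k q m x ≤ ratioCurve k q (m + 1 : ℕ) x := by
      intro x hx
      have hx0 : 0 < x := by linarith
      refine div_le_div_of_nonneg_right ?_ (geom_denom_pos hk hx0).le
      have : 1 ≤ x ^ k := one_le_pow₀ hx
      push_cast
      linarith
    have hstep' : ∀ x : ℝ, 1 < x → ratioCurve k q m x < ratioCurve k q (m + 1 : ℕ) x := by
      intro x hx
      have hx0 : 0 < x := by linarith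
      refine div_lt_div_of_pos_right ?_ (geom_denom_pos hk hx0)
      have : 1 < x ^ k := one_lt_pow₀ hx (by omega)
      push_cast
      linarith
    by_cases hab : a (m + 1) = a m
    · show ratioCurve k q m (a m) < ratioCurve k q (m + 1 : ℕ) (a (m + 1))
      rw [hab]
      exact hstep' _ ((ha m h1 (by omega)).2.1 (by omega))
    · exact (hle m h1 (by omega) _ hb hab).trans_le (hstep _ hb)
  · intro c m h1 h2
    obtain ⟨ha1, -, -, hanti, hmono⟩ := ha m h1 h2
    have hone : ratioCurve k q m (a m) < q / ((k : ℝ) - 1) → 1 < a m := by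
      intro h
      refine lt_of_le_of_ne ha1 fun h' => ?_
      rw [← h', ratioCurve_one hk] at h
      exact lt_irrefl _ h
    have hone' : 1 < a m → ratioCurve k q m (a m) < q / ((k : ℝ) - 1) := by
      intro h
      rw [← ratioCurve_one (m := m) hk]
      exact hle m h1 h2 1 le_rfl h.ne
    rw [encard_level_of_unimodal ha1 (continuousOn_ratioCurve hk) hanti hmono
      (ratioCurve_unbounded hk (by exact_mod_cast h1) (by exact_mod_cast h2)), ratioCurve_one hk]
    have e1 : (1 < a m ∧ ratioCurve k q m (a m) < c ∧ c < q / ((k : ℝ) - 1)) ↔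
        (ratioCurve k q m (a m) < c ∧ c < q / ((k : ℝ) - 1)) :=
      ⟨fun h => h.2, fun h => ⟨hone (h.1.trans h.2), h⟩⟩
    have e2 : (1 < a m ∧ ratioCurve k q m (a m) = c) ↔
        (ratioCurve k q m (a m) = c ∧ c < q / ((k : ℝ) - 1)) :=
      ⟨fun h => ⟨h.2, h.2 ▸ hone' h.1⟩, fun h => ⟨hone (h.1 ▸ h.2), h.1⟩⟩
    simp only [e1, e2]

theorem sum_Ico_choose_eq_sum_Icc {m : ℕ} (hm : m < q) {N : ℕ → ℕ}
    (hN : ∀ s, m < s → s < q → N s = 0) :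
    ∑ s ∈ Finset.Ico 1 q, q.choose s * N s = ∑ s ∈ Finset.Icc 1 m, q.choose s * N s := by
  symm
  refine Finset.sum_subset (fun s hs => ?_) fun s hs hs' => ?_
  · rw [Finset.mem_Icc] at hs; rw [Finset.mem_Ico]; omega
  · rw [Finset.mem_Ico] at hs
    rw [Finset.mem_Icc] at hs'
    rw [hN s (by omega) hs.2, mul_zero]

theorem one_add_sum_Icc_choose (n m : ℕ) :
    1 + ∑ s ∈ Finset.Icc 1 m, n.choose s = ∑ s ∈ Finset.range (m + 1), n.choose s := by
  have : Finset.Icc 1 m = Finset.Ico 1 (m + 1) := by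
    ext s; simp only [Finset.mem_Icc, Finset.mem_Ico]; omega
  rw [this, Finset.range_eq_Ico, Finset.sum_eq_sum_Ico_succ_bot (Nat.succ_pos m),
    Nat.choose_zero_right]

theorem sum_range_choose_odd (hq : Odd q) :
    1 + ∑ s ∈ Finset.Icc 1 (q / 2), q.choose s = 2 ^ (q - 1) := by
  obtain ⟨p, rfl⟩ := hq
  rw [show (2 * p + 1) / 2 = p by omega, one_add_sum_Icc_choose, Nat.sum_range_choose_halfway,
    Nat.add_sub_cancel, pow_mul]
  norm_num

theorem sum_range_choose_even (hq : Even q) (hq0 : 2 ≤ q) :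
    1 + ∑ s ∈ Finset.Icc 1 (q / 2 - 1), q.choose s =
      2 ^ (q - 1) - (q - 1).choose (q / 2) := by
  obtain ⟨r, rfl⟩ : ∃ r, q = 2 * r + 1 + 1 := by
    obtain ⟨p, rfl⟩ := hq
    exact ⟨p - 1, by omega⟩
  rw [show (2 * r + 1 + 1) / 2 = r + 1 by omega, one_add_sum_Icc_choose, Nat.add_sub_cancel,
    Nat.add_sub_cancel, Nat.choose_symm_half, Finset.sum_range_succ']
  have hpascal : ∀ s, (2 * r + 1 + 1).choose (s + 1) =
      (2 * r + 1).choose s + (2 * r + 1).choose (s + 1) := fun s => Nat.choose_succ_succ' _ _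
  simp only [hpascal, Finset.sum_add_distrib]
  have h1 := Nat.sum_range_choose_halfway r
  have h2 := h1
  rw [Finset.sum_range_succ] at h1
  rw [Finset.sum_range_succ'] at h2
  have h3 : 2 ^ (2 * r + 1) = 2 * 4 ^ r := by rw [pow_succ, pow_mul]; norm_num [mul_comm]
  simp only [Nat.choose_zero_right] at h2 ⊢
  omega

theorem lt_temperature_iff {J T κ : ℝ} (hT : 0 < T) (hκ : 0 < κ) :
    T < J / Real.log (1 + κ) ↔ κ < Real.exp (J / T) - 1 := by
  have hL : 0 < Real.log (1 + κ) := Real.log_pos (by linarith)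
  rw [lt_div_iff₀ hL, ← lt_div_iff₀' hT, Real.log_lt_iff_lt_exp (by linarith), lt_sub_iff_add_lt']

theorem temperature_lt_iff {J T κ : ℝ} (hT : 0 < T) (hκ : 0 < κ) :
    J / Real.log (1 + κ) < T ↔ Real.exp (J / T) - 1 < κ := by
  have hL : 0 < Real.log (1 + κ) := Real.log_pos (by linarith)
  rw [div_lt_iff₀ hL, ← div_lt_iff₀' hT, Real.lt_log_iff_exp_lt (by linarith), sub_lt_iff_lt_add']

theorem eq_temperature_iff {J T κ : ℝ} (hT : 0 < T) (hκ : 0 < κ) :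
    T = J / Real.log (1 + κ) ↔ κ = Real.exp (J / T) - 1 := by
  rw [eq_iff_le_not_lt, eq_iff_le_not_lt, lt_temperature_iff hT hκ, ← not_lt, ← not_lt,
    temperature_lt_iff hT hκ]

end Potts

open Potts in
theorem theorem1 (k q : ℕ) (hk : 2 ≤ k) (hq : 2 ≤ q) :
    ∃ t : ℕ → ℝ, ∀ (J : ℝ), 0 < J → ∃ Tc : ℕ → ℝ, (∀ m, Tc m = J * t m) ∧
      (∀ m, 1 ≤ m → m + 1 ≤ q / 2 → Tc (m + 1) < Tc m) ∧
      Potts.Tcr k q J ≤ Tc (q / 2) ∧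
      ∀ (V : Type*) (Γ : CayleyTree k V) (T : ℝ), 0 < T →
        (Tc 1 < T → (Potts.TISGM Γ q J T).encard = 1) ∧
        (∀ m, 1 ≤ m → m + 1 ≤ q / 2 → Tc (m + 1) < T → T < Tc m →
          (Potts.TISGM Γ q J T).encard = (1 + 2 * ∑ s ∈ Finset.Icc 1 m, q.choose s : ℕ)) ∧
        (T ≠ Potts.Tcr k q J → T < Tc (q / 2) →
          (Potts.TISGM Γ q J T).encard = (2 ^ q - 1 : ℕ)) ∧
        (T = Potts.Tcr k q J →
          (Odd q → (Potts.TISGM Γ q J T).encard = (2 ^ (q - 1) : ℕ)) ∧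
          (Even q → (Potts.TISGM Γ q J T).encard =
            (2 ^ (q - 1) - (q - 1).choose (q / 2) : ℕ))) ∧
        (∀ m, 1 ≤ m → m ≤ q / 2 → Tc m ≠ Potts.Tcr k q J → T = Tc m →
          (Potts.TISGM Γ q J T).encard =
            (1 + q.choose m + 2 * ∑ s ∈ Finset.Icc 1 (m - 1), q.choose s : ℕ)) := by
  obtain ⟨κ, hκ0, hκlt, hκeq, hκstep, hcount⟩ := exists_criticalValues hk hq
  set κs : ℝ := q / ((k : ℝ) - 1) with hκs
  have hκs0 : 0 < κs := div_pos (by exact_mod_cast (by omega : 0 < q))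
    (sub_pos.2 (by exact_mod_cast (by omega : 1 < k)))
  have hκle : ∀ m, 1 ≤ m → m < q → κ m ≤ κs := by
    intro m h1 h2
    rcases Nat.lt_or_ge (2 * m) q with h | h
    exacts [(hκlt m h1 h).le, (hκeq m h h2).le]
  have hκmono : ∀ s m, 1 ≤ s → s < m → m ≤ q / 2 → κ s < κ m := by
    intro s m h1 h2
    induction m, h2 using Nat.le_induction with
    | base => exact hκstep s h1
    | succ n hn ih => exact fun h => (ih (by omega)).trans (hκstep n (by omega) h)
  refine ⟨fun m => 1 / Real.log (1 + κ m), fun J hJ =>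
    ⟨fun m => J / Real.log (1 + κ m), fun m => by ring, ?_, ?_, ?_⟩⟩
  · intro m h1 h2
    have h3 := hκ0 m h1 (by omega)
    exact div_lt_div_of_pos_left hJ (Real.log_pos (by linarith))
      (Real.log_lt_log (by linarith) (by linarith [hκstep m h1 h2]))
  · have h3 := hκ0 (q / 2) (by omega) (by omega)
    exact div_le_div_of_nonneg_left hJ.le (Real.log_pos (by linarith))
      (Real.log_le_log (by linarith) (by linarith [hκle (q / 2) (by omega) (by omega)]))
  intro V Γ T hT
  set c : ℝ := Real.exp (J / T) - 1 with hc
  have hc0 : 0 < c := sub_pos.2 (Real.one_lt_exp_iff.2 (div_pos hJ hT))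
  have htotal : ∀ N : ℕ → ℕ, (∀ m, 1 ≤ m → m < q → N m =
      (if κ m < c ∧ c < κs then 1 else 0) + (if κ m < c then 1 else 0) +
        (if κ m = c ∧ c < κs then 1 else 0)) →
      (TISGM Γ q J T).encard = (1 + ∑ m ∈ Finset.Ico 1 q, q.choose m * N m : ℕ) := by
    intro N hN
    rw [encard_TISGM hk (by omega) Γ hJ hT]
    refine encard_fixedPoints hk (by omega) hc0 N fun m h1 h2 => ?_
    rw [hcount c m h1 h2, hN m h1 h2]
  -- below `κs`, two boundary laws per set of at most `m` spins and none for larger sets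
  have hlow : ∀ m, m ≤ q / 2 → (∀ s, 1 ≤ s → s ≤ m → κ s < c) →
      (∀ s, m < s → s < q → c < κ s) → c < κs →
      (TISGM Γ q J T).encard = (1 + 2 * ∑ s ∈ Finset.Icc 1 m, q.choose s : ℕ) := by
    intro m hm h1 h2 h3
    rw [htotal (fun s => if s ≤ m then 2 else 0), sum_Ico_choose_eq_sum_Icc (m := m) (by omega),
      Finset.mul_sum]
    · congr 2
      refine Finset.sum_congr rfl fun s hs => ?_
      rw [if_pos (Finset.mem_Icc.1 hs).2, mul_comm]
    · intro s hs _; exact if_neg (by omega)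
    · intro s hs1 hs2
      by_cases h : s ≤ m
      · simp [h, h1 s hs1 h, h3, (h1 s hs1 h).ne]
      · have := h2 s (by omega) hs2
        simp [h, this.not_gt, this.ne']
  have hcr : T = Tcr k q J ↔ κs = c := eq_temperature_iff hT hκs0
  refine ⟨fun h => ?_, fun m h1 h2 h3 h4 => ?_, fun h1 h2 => ?_, fun h => ?_,
    fun m h1 h2 h3 h4 => ?_⟩
  · rw [temperature_lt_iff hT (hκ0 1 le_rfl (by omega))] at h
    have hall : ∀ s, 0 < s → s < q → c < κ s := by
      intro s hs1 hs2
      rcases Nat.lt_or_ge (q / 2) s with hs | hs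
      · rw [hκeq s (by omega) hs2]
        exact h.trans_le (hκle 1 le_rfl (by omega))
      · rcases Nat.eq_or_lt_of_le hs1 with rfl | hs1
        exacts [h, h.trans (hκmono 1 s le_rfl hs1 hs)]
    have := hlow 0 (by omega) (fun s h1 h2 => by omega) hall
      (h.trans_le (hκle 1 le_rfl (by omega)))
    simpa using this
  · rw [temperature_lt_iff hT (hκ0 (m + 1) (by omega) (by omega))] at h3
    rw [lt_temperature_iff hT (hκ0 m h1 (by omega))] at h4
    have h5 : c < κs := h3.trans_le (hκle (m + 1) (by omega) (by omega))
    refine hlow m (by omega) (fun s hs1 hs2 => ?_) (fun s hs1 hs2 => ?_) h5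
    · rcases Nat.eq_or_lt_of_le hs2 with rfl | hs2
      exacts [h4, (hκmono s m hs1 hs2 (by omega)).trans h4]
    · rcases Nat.lt_or_ge (q / 2) s with hs | hs
      · rwa [hκeq s (by omega) hs2]
      · rcases Nat.eq_or_lt_of_le (Nat.succ_le_of_lt hs1) with rfl | hs1
        exacts [h3, h3.trans (hκmono (m + 1) s (by omega) hs1 hs)]
  · rw [lt_temperature_iff hT (hκ0 (q / 2) (by omega) (by omega))] at h2
    rcases lt_or_gt_of_ne (fun h => h1 (hcr.2 h.symm) : c ≠ κs) with h3 | h3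
    · have hodd : Odd q := by
        by_contra hev
        rw [Nat.not_odd_iff_even] at hev
        obtain ⟨p, hp⟩ := hev
        rw [hκeq (q / 2) (by omega) (by omega)] at h2
        exact absurd h2 h3.not_gt
      rw [hlow (q / 2) le_rfl (fun s hs1 hs2 => ?_) (fun s hs1 hs2 => ?_) h3]
      · have e1 := sum_range_choose_odd hodd
        have e2 : 2 ^ q = 2 * 2 ^ (q - 1) := by rw [← pow_succ']; congr 1; omega
        congr 1
        omega
      · rcases Nat.eq_or_lt_of_le hs2 with rfl | hs2
        exacts [h2, (hκmono s _ hs1 hs2 le_rfl).trans h2]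
      · rwa [hκeq s (by omega) hs2]
    -- above `κs`, one boundary law per proper nonempty set of spins
    · rw [htotal fun _ => 1]
      · congr 1
        have e1 := Nat.sum_range_choose q
        rw [Finset.sum_range_succ, Nat.choose_self, Finset.range_eq_Ico,
          Finset.sum_eq_sum_Ico_succ_bot (by omega), Nat.choose_zero_right] at e1
        simp only [mul_one, zero_add] at e1 ⊢
        omega
      · intro m hm1 hm2
        have := (hκle m hm1 hm2).trans_lt h3
        simp [this, h3.not_gt]
  · rw [hcr] at h
    -- at `κs`, the lower of the two solutions for each set of fewer than `q / 2` spins is `1`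
    have hcr' : ∀ m, m ≤ q / 2 → (∀ s, 1 ≤ s → (s ≤ m ↔ 2 * s < q)) →
        (TISGM Γ q J T).encard = (1 + ∑ s ∈ Finset.Icc 1 m, q.choose s : ℕ) := by
      intro m hm hms
      rw [htotal (fun s => if s ≤ m then 1 else 0), sum_Ico_choose_eq_sum_Icc (m := m) (by omega)]
      · congr 2
        refine Finset.sum_congr rfl fun s hs => ?_
        rw [if_pos (Finset.mem_Icc.1 hs).2, mul_one]
      · intro s hs _; exact if_neg (by omega)
      · intro s hs1 hs2
        by_cases h' : s ≤ m
        · have := hκlt s hs1 ((hms s hs1).1 h')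
          rw [h] at this
          simp [h', this, h]
        · have := hκeq s (by rw [hms s hs1] at h'; omega) hs2
          simp [h', this, h]
    refine ⟨fun hodd => ?_, fun heven => ?_⟩
    · obtain ⟨p, hp⟩ := id hodd
      rw [hcr' (q / 2) le_rfl fun s _ => by omega, sum_range_choose_odd hodd]
    · obtain ⟨p, hp⟩ := id heven
      rw [hcr' (q / 2 - 1) (by omega) fun s _ => by omega, sum_range_choose_even heven hq]
  · have hm0 := hκ0 m h1 (by omega)
    have h5 : κ m = c := (eq_temperature_iff hT hm0).1 h4
    have hm2 : 2 * m < q := by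
      by_contra hm2
      refine h3 (h4.symm.trans (hcr.2 ?_))
      rw [← h5, hκeq m (by omega) (by omega)]
    have h6 : c < κs := h5 ▸ hκlt m h1 hm2
    rw [htotal fun s => if s < m then 2 else if s = m then 1 else 0,
      sum_Ico_choose_eq_sum_Icc (m := m) (by omega)]
    · obtain ⟨n, rfl⟩ : ∃ n, m = n + 1 := ⟨m - 1, by omega⟩
      rw [Finset.sum_Icc_succ_top (by omega), Nat.add_sub_cancel, Finset.mul_sum, if_neg (by omega),
        if_pos rfl, mul_one, add_assoc, add_comm (q.choose (n + 1))]
      congr 3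
      refine Finset.sum_congr rfl fun s hs => ?_
      rw [if_pos (by have := (Finset.mem_Icc.1 hs).2; omega), mul_comm]
    · intro s hs _; rw [if_neg (by omega), if_neg (by omega)]
    · intro s hs1 hs2
      rcases lt_trichotomy s m with hs | rfl | hs
      · have := hκmono s m hs1 hs h2
        rw [h5] at this
        simp [hs, this, h6, this.ne]
      · simp [h5, h6]
      · have : c < κ s := by
          rcases Nat.lt_or_ge (q / 2) s with hs' | hs'
          · rwa [hκeq s (by omega) hs2]
          · exact h5 ▸ hκmono m s h1 hs hs'
        simp [hs.not_gt, hs.ne', this.not_gt, this.ne']
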